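/- Consider a Lagrangian control system in local coordinates $q=(q^1,\dots,q^p)$ on an open configuration space, with Lagrangian $L(q,\dot q)=\tfrac12 g(\dot q,\dot q)-V(q)$ ($g$ a Riemannian metric), equations of motion $\frac{d}{dt}\frac{\partial L}{\partial \dot q^i}-\frac{\partial L}{\partial q^i}=\sum_{j=1}^{p-1}G_{ij}(q)u^j$, $i=1,\dots,p$, $m=p-1$ inputs $u$, all data smooth. Let $(q_s,0,u_s)$ be an equilibrium. Assume that the system has a configuration flat output $y=\varphi(q)\in\mathbb R^{p-1}$ whose parameterization $q=F_q(y,y_{[1]},\dots)$, $u=F_u(y,y_{[1]},\dots)$ is well defined and smooth around the equilibrium: it depends on finitely many time derivatives $y_{[i]}$ of $y$, every output curve $y(t)$ whose derivatives are close to those of the constant $y_s=\varphi(q_s)$ determines a trajectory with output $y(t)$, and every trajectory close to the equilibrium is recovered in this way from its output. Let $1\le k\le p-1$. Assume that around the equilibrium the equations of motion can be solved smoothly and uniquely for $u^1,\dots,u^k,\ddot q^{k+1},\dots,\ddot q^p$ as functions of $q,\dot q,\ddot q^1,\dots,\ddot q^k,u^{k+1},\dots,u^{p-1}$. Taking $\tilde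 u=(q^1,\dots,q^k,u^{k+1},\dots,u^{p-1})$ as input and $\tilde q=(q^{k+1},\dots,q^p)$, one obtains the generalized Lagrangian control system $\dot{\tilde q}=\tilde v$, $\dot{\tilde v}=\tilde f(\tilde q,\tilde v,\tilde u,\tilde u_{[1]},\tilde u_{[2]})$. Let $F_{\tilde q}$ consist of the last $p-k$ components of $F_q$. Say that $\kappa=(\kappa^1,\dots,\kappa^{p-1})\in\mathbb N^{p-1}$ is achievable if there is a quasi-static feedback law $\tilde u=\alpha(\tilde q,\tilde v,w,w_{[1]},\dots,w_{[N]})$ of the generalized state, for some $N$, well defined (smooth) around the equilibrium and preserving it, together with smooth functions $\alpha_{[1]},\alpha_{[2]}$ of the same arguments, vanishing at the equilibrium, which are its first and second time derivatives along the closed loop $\dot{\tilde q}=\tilde v$, $\dot{\tilde v}=\tilde f(\tilde q,\tilde v,\alpha,\alpha_{[1]},\alpha_{[2]})$, such that every solution of the closed loop near the equilibrium satisfies $y^j_{[\kappa^j]}=w^j$ for $j=1,\dots,p-1$. (At the equilibrium, $w^j=y^j_s$ if $\kappa^j=0$, $w^j=0$ otherwise, and the derivatives of $w$ vanish.) Then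 every achievable $\kappa$ takes, after a permutation of the components of $y$ (and correspondingly of $\kappa$), one of the two forms (i) $\kappa^j=2$ for $j\in\{1,\dots,p-k\}$ and $\kappa^j=0$ for all other $j$; (ii) $\kappa^j=4$ for one $j\in\{1,\dots,p-k-1\}$, $\kappa^i=2$ for all other $i\in\{1,\dots,p-k-1\}$, and $\kappa^i=0$ for $i\in\{p-k,\dots,p-1\}$. Moreover, for each permuted flat output: the $\kappa$ of form (i) is achievable if and only if, with $\bar y=(y^1,\dots,y^{p-k})$, $$\operatorname{rank}\bigl(\partial_{\bar y}F_{\tilde q}|_{y_s}\bigr)=p-k;$$ and, for each $j\in\{1,\dots,p-k-1\}$, the $\kappa$ of form (ii) with $\kappa^j=4$ is achievable if and only if, with $\bar y=(y^1,\dots,y^{p-k-1})$, $$\operatorname{rank}\bigl(\partial_{\bar y}F_{\tilde q}|_{y_s},\ \partial_{\bar y^j_{[2]}}F_{\tilde q}|_{y_s}\bigr)=p-k.$$ -/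

import Mathlib

open scoped ContDiff

namespace LagrangianFlatness

noncomputable section

/-- Configurations, velocities and accelerations with `p = m + 1` degrees of freedom, in local
coordinates. -/
abbrev Cfg (m : ℕ) : Type := Fin (m + 1) → ℝ

/-- Values of `m`-tuples: inputs `u`, new inputs `w` and outputs `y`. -/
abbrev Tup (m : ℕ) : Type := Fin m → ℝ

/-- Jets of order `r` of an `m`-tuple: `J i j` is the `i`-th time derivative of component `j`. -/
abbrev Jet (r m : ℕ) : Type := Fin (r + 1) → Fin m → ℝ

/-- Indices of the configuration variables that remain state variables when the first `k`
configuration variables are taken as inputs (there are `p - k = m + 1 - k` of them). -/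
abbrev StIdx (m k : ℕ) : Type := {i : Fin (m + 1) // k ≤ i.val}

/-- The `r`-jet of a curve at time `t`. -/
def jet {m : ℕ} (r : ℕ) (c : ℝ → Tup m) (t : ℝ) : Jet r m := fun i => iteratedDeriv i.val c t

/-- The `r`-jet of the constant curve with value `c`. -/
def constJet {m : ℕ} (r : ℕ) (c : Tup m) : Jet r m := fun i => if i.val = 0 then c else 0

/-- The coordinate direction of `y^j_[i]` in the space of `r`-jets. It is zero if `i > r`, since a
function of `r`-jets does not depend on `y^j_[i]` then. -/
def jetDir {m : ℕ} (r i : ℕ) (j : Fin m) : Jet r m := fun a b => if a.val = i ∧ b = j then 1 else 0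

/-- A Lagrangian control system with `m + 1` degrees of freedom and `m` inputs on a configuration
space `Q` covered by one chart: a Riemannian metric `g`, a potential `V`, and input fields `G`. -/
structure LCSystem (m : ℕ) where
  Q : Set (Cfg m)
  isOpen_Q : IsOpen Q
  g : Cfg m → Matrix (Fin (m + 1)) (Fin (m + 1)) ℝ
  g_smooth : ∀ i j, ContDiffOn ℝ ∞ (fun q => g q i j) Q
  g_posDef : ∀ q ∈ Q, (g q).PosDef
  V : Cfg m → ℝ
  V_smooth : ContDiffOn ℝ ∞ V Q
  G : Cfg m → Matrix (Fin (m + 1)) (Fin m) ℝ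
  G_smooth : ∀ i j, ContDiffOn ℝ ∞ (fun q => G q i j) Q

namespace LCSystem

variable {m : ℕ}

/-- The Lagrangian, kinetic minus potential energy. -/
def lagrangian (S : LCSystem m) (q v : Cfg m) : ℝ :=
  (1 / 2) * (v ⬝ᵥ (S.g q).mulVec v) - S.V q

/-- The generalized momentum `∂L/∂v^i`. -/
def momentum (S : LCSystem m) (i : Fin (m + 1)) (x : Cfg m × Cfg m) : ℝ :=
  fderiv ℝ (fun v => S.lagrangian x.1 v) x.2 (Pi.single i 1)

/-- The Euler-Lagrange expression `d/dt (∂L/∂v^i) - ∂L/∂q^i` at position `q`, velocity `v` and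
acceleration `a`. -/
def eulerLagrange (S : LCSystem m) (q v a : Cfg m) (i : Fin (m + 1)) : ℝ :=
  fderiv ℝ (S.momentum i) (q, v) (v, a)
    - fderiv ℝ (fun q' => S.lagrangian q' v) q (Pi.single i 1)

/-- The equations of motion `d/dt (∂L/∂v^i) - ∂L/∂q^i = G_{ij}(q) u^j`. -/
def EqOfMotion (S : LCSystem m) (q v a : Cfg m) (u : Tup m) : Prop :=
  ∀ i, S.eulerLagrange q v a i = ∑ j, S.G q i j * u j

/-- Smooth solutions of the equations of motion on an open set `I` of times. -/
structure IsTrajectory (S : LCSystem m) (I : Set ℝ) (q : ℝ → Cfg m) (u : ℝ → Tup m) : Prop where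
  isOpen : IsOpen I
  smooth_q : ContDiffOn ℝ ∞ q I
  smooth_u : ContDiffOn ℝ ∞ u I
  mem : ∀ t ∈ I, q t ∈ S.Q
  motion : ∀ t ∈ I, S.EqOfMotion (q t) (deriv q t) (iteratedDeriv 2 q t) (u t)

/-- `(qs, 0, us)` is an equilibrium. -/
def IsEquilibrium (S : LCSystem m) (qs : Cfg m) (us : Tup m) : Prop :=
  qs ∈ S.Q ∧ S.EqOfMotion qs 0 0 us

/-- `y = φ(q)` is a configuration flat output around the equilibrium `(qs, 0, us)`, with the
parameterization `q = F_q(y, …, y_[r])`, `u = F_u(y, …, y_[r])`, which is well defined around the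
equilibrium. Differentiating the first equation parameterizes the velocities. Every output curve
with jets in `U`, a neighbourhood of the jet of `ys = φ(qs)`, comes from a trajectory, so the
output is differentially independent. -/
structure ConfigFlat (S : LCSystem m) (qs : Cfg m) (us : Tup m) where
  φ : Cfg m → Tup m
  φ_smooth : ContDiffOn ℝ ∞ φ S.Q
  r : ℕ
  U : Set (Jet r m)
  isOpen_U : IsOpen U
  mem_U : constJet r (φ qs) ∈ U
  Fq : Jet r m → Cfg m
  Fu : Jet r m → Tup m
  Fq_smooth : ContDiffOn ℝ ∞ Fq U
  Fu_smooth : ContDiffOn ℝ ∞ Fu U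
  /-- Each output curve near the equilibrium determines a trajectory having it as its output. -/
  of_output : ∀ (I : Set ℝ) (y : ℝ → Tup m), IsOpen I → ContDiffOn ℝ ∞ y I →
    (∀ t ∈ I, jet r y t ∈ U) →
      S.IsTrajectory I (fun t => Fq (jet r y t)) (fun t => Fu (jet r y t)) ∧
        ∀ t ∈ I, φ (Fq (jet r y t)) = y t
  /-- Near the equilibrium, trajectories are recovered from their output. -/
  of_trajectory : ∃ (l : ℕ) (W : Set (Cfg m × Cfg m × Jet l m)), IsOpen W ∧
    (qs, 0, constJet l us) ∈ W ∧
      ∀ (I : Set ℝ) (q : ℝ → Cfg m) (u : ℝ → Tup m), S.IsTrajectory I q u →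
        (∀ t ∈ I, (q t, deriv q t, jet l u t) ∈ W) →
          ∀ t ∈ I, jet r (fun s => φ (q s)) t ∈ U ∧
            q t = Fq (jet r (fun s => φ (q s)) t) ∧ u t = Fu (jet r (fun s => φ (q s)) t)

end LCSystem

section Generalized

variable {m k : ℕ}

/-- The part `(c^{k+1}, …, c^p)` of a configuration, velocity or acceleration. -/
def statePart (k : ℕ) (c : Cfg m) : StIdx m k → ℝ := fun i => c i.val

/-- The tuple `(c^1, …, c^k, u^{k+1}, …, u^m)`. -/
def mixed (k : ℕ) (c : Cfg m) (u : Tup m) : Tup m :=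
  fun i => if i.val < k then c i.castSucc else u i

/-- The configuration (or velocity, or acceleration) whose first `k` components are those of the
tuple `c` and whose other components are given by `s`. -/
def assemble (hk : k ≤ m) (s : StIdx m k → ℝ) (c : Tup m) : Cfg m :=
  fun i => if h : k ≤ i.val then s ⟨i, h⟩ else c ⟨i.val, by omega⟩

namespace LCSystem

/-- Solving the equations of motion, around an equilibrium, for the forces `u^1, …, u^k` and the
accelerations `a^{k+1}, …, a^p`: these become functions `force` (only its first `k` components
matter) and `acc` of `q`, `v` and `(a^1, …, a^k, u^{k+1}, …, u^m)`. -/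
structure GenRep (S : LCSystem m) (k : ℕ) (qs : Cfg m) (us : Tup m) where
  D : Set (Cfg m × Cfg m × Tup m)
  isOpen_D : IsOpen D
  mem_D : (qs, 0, mixed k 0 us) ∈ D
  force : Cfg m × Cfg m × Tup m → Tup m
  acc : Cfg m × Cfg m × Tup m → (StIdx m k → ℝ)
  force_smooth : ContDiffOn ℝ ∞ force D
  acc_smooth : ContDiffOn ℝ ∞ acc D
  solves : ∀ (q v a : Cfg m) (u : Tup m), (q, v, mixed k a u) ∈ D →
    (S.EqOfMotion q v a u ↔
      (∀ i : Fin m, i.val < k → u i = force (q, v, mixed k a u) i) ∧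
        statePart k a = acc (q, v, mixed k a u))

/-- The right-hand side `f̃(q̃, ṽ, ũ, ũ_[1], ũ_[2])` of the generalized Lagrangian control system
`q̃' = ṽ`, `ṽ' = f̃`, whose input is `ũ = (q^1, …, q^k, u^{k+1}, …, u^m)`. Of the derivatives of
`ũ` only those of the first `k` components occur. -/
def GenRep.rhs {S : LCSystem m} {qs : Cfg m} {us : Tup m} (R : S.GenRep k qs us) (hk : k ≤ m)
    (qt vt : StIdx m k → ℝ) (u0 u1 u2 : Tup m) : StIdx m k → ℝ :=
  R.acc (assemble hk qt u0, assemble hk vt u1, fun i => if i.val < k then u2 i else u0 i)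

end LCSystem

/-- The arguments `(q̃, ṽ, w, w_[1], …, w_[N])` of a quasi-static feedback of the generalized
state. -/
abbrev FbArg (m k N : ℕ) : Type := (StIdx m k → ℝ) × (StIdx m k → ℝ) × Jet N m

/-- The arguments of the feedback along curves `q̃` and `w`. -/
def fbArg (N : ℕ) (qt : ℝ → StIdx m k → ℝ) (w : ℝ → Tup m) (t : ℝ) : FbArg m k N :=
  (qt t, deriv qt t, jet N w t)

/-- The constant value of `w = y_[κ]` at the equilibrium with output `ys`. -/
def inputAtRest (κ : Fin m → ℕ) (ys : Tup m) : Tup m := fun j => if κ j = 0 then ys j else 0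

namespace LCSystem

/-- Smooth solutions `(q̃, w)`, on an open set `I` of times and with values in the domain `A` of the
feedback, of the closed-loop system
`q̃' = ṽ`, `ṽ' = f̃(q̃, ṽ, α_[0,2](q̃, ṽ, w, w_[1], …))`. -/
structure IsClosedLoop {S : LCSystem m} {qs : Cfg m} {us : Tup m} (R : S.GenRep k qs us)
    (hk : k ≤ m) (N : ℕ) (α : Fin 3 → FbArg m k N → Tup m) (A : Set (FbArg m k N))
    (I : Set ℝ) (qt : ℝ → StIdx m k → ℝ) (w : ℝ → Tup m) : Prop where
  isOpen : IsOpen I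
  smooth_q : ContDiffOn ℝ ∞ qt I
  smooth_w : ContDiffOn ℝ ∞ w I
  mem : ∀ t ∈ I, fbArg N qt w t ∈ A
  motion : ∀ t ∈ I, iteratedDeriv 2 qt t =
    R.rhs hk (qt t) (deriv qt t) (α 0 (fbArg N qt w t)) (α 1 (fbArg N qt w t))
      (α 2 (fbArg N qt w t))

/-- There is a quasi-static feedback law `ũ = α(q̃, ṽ, w, w_[1], …, w_[N])` of the generalized
state, smooth on a neighbourhood `A` of the equilibrium and preserving it, such that the closed-loop
system exhibits the input-output behaviour `y^j_[κ^j] = w^j` for all `j`.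
Here `α 0` is the feedback, and `α 1`, `α 2` are its time derivatives along the closed loop, as
functions of the same arguments. -/
def LinearizableBy {S : LCSystem m} {qs : Cfg m} {us : Tup m} (R : S.GenRep k qs us)
    (hk : k ≤ m) (P : S.ConfigFlat qs us) (κ : Fin m → ℕ) : Prop :=
  ∃ (N : ℕ) (α : Fin 3 → FbArg m k N → Tup m) (A : Set (FbArg m k N)),
    IsOpen A ∧
    (statePart k qs, 0, constJet N (inputAtRest κ (P.φ qs))) ∈ A ∧
    (∀ i, ContDiffOn ℝ ∞ (α i) A) ∧
    α 0 (statePart k qs, 0, constJet N (inputAtRest κ (P.φ qs))) = mixed k qs us ∧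
    α 1 (statePart k qs, 0, constJet N (inputAtRest κ (P.φ qs))) = 0 ∧
    α 2 (statePart k qs, 0, constJet N (inputAtRest κ (P.φ qs))) = 0 ∧
    ∀ (I : Set ℝ) (qt : ℝ → StIdx m k → ℝ) (w : ℝ → Tup m),
      IsClosedLoop R hk N α A I qt w → ∀ t ∈ I,
        HasDerivAt (fun s => α 0 (fbArg N qt w s)) (α 1 (fbArg N qt w t)) t ∧
        HasDerivAt (fun s => α 1 (fbArg N qt w s)) (α 2 (fbArg N qt w t)) t ∧
        ∀ j, iteratedDeriv (κ j)
          (fun s => P.φ (assemble hk (qt s) (α 0 (fbArg N qt w s))) j) t = w t j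

/-- The matrix `∂F_q̃ / ∂y_[i]` at the equilibrium `ys = φ(qs)`: rows are the components of `q̃`,
columns those of `y`. -/
def ConfigFlat.jac {S : LCSystem m} {qs : Cfg m} {us : Tup m} (P : S.ConfigFlat qs us)
    (k i : ℕ) : Matrix (StIdx m k) (Fin m) ℝ :=
  Matrix.of fun a j => fderiv ℝ P.Fq (constJet P.r (P.φ qs)) (jetDir P.r i j) a.val

end LCSystem

/-- The multi-index with entry `2` in the first `n` places and `0` elsewhere. -/
def kappaOne (m n : ℕ) : Fin m → ℕ := fun i => if i.val < n then 2 else 0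

/-- The multi-index with entry `4` in place `j`, entry `2` in the others of the first `n` places,
and `0` elsewhere (used for `j` among the first `n` places). -/
def kappaTwo (m n : ℕ) (j : Fin m) : Fin m → ℕ :=
  fun i => if i = j then 4 else if i.val < n then 2 else 0

/-- The first `n` columns of a matrix after its columns have been permuted by `σ`. -/
def firstCols {ι : Type} (n : ℕ) (σ : Equiv.Perm (Fin m)) (B : Matrix ι (Fin m) ℝ) :
    Matrix ι {i : Fin m // i.val < n} ℝ :=
  B.submatrix id fun i => σ i.val

/-- A single column of a matrix. -/
def oneCol {ι : Type} (j : Fin m) (B : Matrix ι (Fin m) ℝ) : Matrix ι Unit ℝ :=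
  B.submatrix id fun _ => j

end Generalized

end

end LagrangianFlatness

/-! Everything is decided by the linearization at the equilibrium. Let `a i j` be the derivative of
`F_q` with respect to `y^j_[i]` there. Differentiating `φ(F_q) = y` puts all `a i j` with `i > 0` in
the kernel of `dφ`, which is a line. A covector annihilating the `p - 1` input columns turns the
linearized equations of motion into one input-free relation, which at rest has no velocity term.
Together these leave only the orders `0` and `2`, with all `a 2 j` on one line
(`columns_of_flat_relation`, `columns`). So, to first order, `q̃ = M₀ y + M₂ y_[2]` and `ṽ = M₀
y_[1] + M₂ y_[3]`, where `M₂` has rank at most one.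

Achievability of `κ` is equivalent to bijectivity of `stateMap`, which sends the derivatives of
`y^j` of order below `κ^j` to `(q̃, ṽ)`. Given a feedback, the closed loop is a vector field in
`(q̃, ṽ, w, …, w_[N])`; its linearization expresses those derivatives through the generalized state
and thereby inverts `stateMap` (`stateMap_bijective_of_linearizableBy`). Conversely, if `stateMap`
is bijective, the inverse function theorem recovers the derivatives of `y` from `(q̃, ṽ)` and the
jet of `w`; substituting them in the parameterization of `ũ` gives the feedback
(`linearizableBy_of_stateMap_bijective`).

The rest is linear algebra. No derivative of order above `3` enters, so `κ^j ≤ 4`; counting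
dimensions separately for `q̃` and `ṽ` leaves the entries `0`, `2`, `4`; and `M₂` having rank at
most one allows a single `4` (`forms_of_stateMap_bijective`). For such `κ` the dimensions agree, so
bijectivity is surjectivity, which is the rank condition (`stateMap_bijective_iff_rank_one`,
`stateMap_bijective_iff_rank_two`). -/

namespace LagrangianFlatness

noncomputable section

/-! ### Lie derivatives along a smooth vector field and their linearization at a zero. -/

section VectorField

variable {E V : Type*} [NormedAddCommGroup E] [NormedSpace ℝ E]
  [NormedAddCommGroup V] [NormedSpace ℝ V]

/-- The derivative of `h` along the vector field `f`. -/
def lieD (f : E → E) (h : E → V) (z : E) : V := fderiv ℝ h z (f z)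

/-- A solution of `z' = f z` on the set `I` of times, with values in `O`. -/
def IsSol (f : E → E) (O : Set E) (I : Set ℝ) (Z : ℝ → E) : Prop :=
  ∀ t ∈ I, Z t ∈ O ∧ HasDerivAt Z (f (Z t)) t

theorem contDiffOn_lieD {f : E → E} {h : E → V} {O : Set E} (hO : IsOpen O)
    (hf : ContDiffOn ℝ ∞ f O) (hh : ContDiffOn ℝ ∞ h O) : ContDiffOn ℝ ∞ (lieD f h) O :=
  (hh.fderiv_of_isOpen hO (m := ∞) (by simp)).clm_apply hf

theorem contDiffOn_lieD_iterate {f : E → E} {h : E → V} {O : Set E} (hO : IsOpen O)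
    (hf : ContDiffOn ℝ ∞ f O) (hh : ContDiffOn ℝ ∞ h O) (i : ℕ) :
    ContDiffOn ℝ ∞ ((lieD f)^[i] h) O := by
  induction i with
  | zero => exact hh
  | succ i ih =>
    rw [Function.iterate_succ_apply']
    exact contDiffOn_lieD hO hf ih

theorem _root_.ContDiffOn.hasFDerivAt_of_isOpen {h : E → V} {O : Set E} (hh : ContDiffOn ℝ ∞ h O)
    (hO : IsOpen O) {z : E} (hz : z ∈ O) : HasFDerivAt h (fderiv ℝ h z) z :=
  ((hh.contDiffAt (hO.mem_nhds hz)).differentiableAt (by simp)).hasFDerivAt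

theorem lieD_congr {f : E → E} {h h' : E → V} {O : Set E} (hO : IsOpen O)
    (hh : Set.EqOn h h' O) : Set.EqOn (lieD f h) (lieD f h') O := by
  intro z hz
  have : h =ᶠ[nhds z] h' := Filter.eventuallyEq_of_mem (hO.mem_nhds hz) hh
  simp only [lieD, this.fderiv_eq]

theorem lieD_clm_comp {V' : Type*} [NormedAddCommGroup V'] [NormedSpace ℝ V'] (L : V →L[ℝ] V')
    {f : E → E} {h : E → V} {O : Set E} (hO : IsOpen O) (hh : ContDiffOn ℝ ∞ h O) :
    Set.EqOn (lieD f fun z => L (h z)) (fun z => L (lieD f h z)) O := by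
  intro z hz
  have := L.hasFDerivAt.comp z (hh.hasFDerivAt_of_isOpen hO hz)
  simp only [lieD]
  rw [show (fun z => L (h z)) = L ∘ h from rfl, this.fderiv]
  rfl

theorem lieD_iterate_clm_comp {V' : Type*} [NormedAddCommGroup V'] [NormedSpace ℝ V']
    (L : V →L[ℝ] V') {f : E → E} {h : E → V} {O : Set E} (hO : IsOpen O)
    (hf : ContDiffOn ℝ ∞ f O) (hh : ContDiffOn ℝ ∞ h O) (i : ℕ) :
    Set.EqOn ((lieD f)^[i] fun z => L (h z)) (fun z => L ((lieD f)^[i] h z)) O := by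
  induction i with
  | zero => exact fun z _ => rfl
  | succ i ih =>
    rw [Function.iterate_succ_apply', Function.iterate_succ_apply']
    exact (lieD_congr hO ih).trans
      (lieD_clm_comp L hO (contDiffOn_lieD_iterate hO hf hh i))

theorem IsSol.hasDerivAt_comp {f : E → E} {h : E → V} {O : Set E} {I : Set ℝ} {Z : ℝ → E}
    (hZ : IsSol f O I Z) (hO : IsOpen O) (hh : ContDiffOn ℝ ∞ h O) {t : ℝ} (ht : t ∈ I) :
    HasDerivAt (fun s => h (Z s)) (lieD f h (Z t)) t :=
  (hh.hasFDerivAt_of_isOpen hO (hZ t ht).1).comp_hasDerivAt t (hZ t ht).2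

theorem iteratedDeriv_eq_of_hasDerivAt {c : ℝ → V} {d : ℕ → ℝ → V} {I : Set ℝ} (hI : IsOpen I)
    {n : ℕ} (h0 : ∀ t ∈ I, c t = d 0 t)
    (hd : ∀ i < n, ∀ t ∈ I, HasDerivAt (d i) (d (i + 1) t) t) {i : ℕ} (hi : i ≤ n) :
    ∀ t ∈ I, iteratedDeriv i c t = d i t := by
  induction i with
  | zero => simpa using h0
  | succ i ih =>
    intro t ht
    have h1 : iteratedDeriv i c =ᶠ[nhds t] d i :=
      Filter.eventuallyEq_of_mem (hI.mem_nhds ht) (ih (by omega))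
    rw [iteratedDeriv_succ, h1.deriv_eq, (hd i (by omega) t ht).deriv]

theorem IsSol.iteratedDeriv_comp {f : E → E} {h : E → V} {O : Set E} {I : Set ℝ} {Z : ℝ → E}
    (hZ : IsSol f O I Z) (hO : IsOpen O) (hI : IsOpen I) (hf : ContDiffOn ℝ ∞ f O)
    (hh : ContDiffOn ℝ ∞ h O) (i : ℕ) {t : ℝ} (ht : t ∈ I) :
    iteratedDeriv i (fun s => h (Z s)) t = (lieD f)^[i] h (Z t) := by
  refine iteratedDeriv_eq_of_hasDerivAt (d := fun i s => (lieD f)^[i] h (Z s))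
    (n := i) hI
    (fun _ _ => rfl) (fun j _ s hs => ?_) le_rfl t ht
  simp only [Function.iterate_succ_apply']
  exact hZ.hasDerivAt_comp hO (contDiffOn_lieD_iterate hO hf hh j) hs

theorem IsSol.contDiffOn {f : E → E} {O : Set E} {I : Set ℝ} {Z : ℝ → E}
    (hZ : IsSol f O I Z) (hI : IsOpen I) (hf : ContDiffOn ℝ ∞ f O) :
    ContDiffOn ℝ ∞ Z I := by
  rw [contDiffOn_infty]
  intro n
  induction n with
  | zero =>
    exact contDiffOn_zero.2 fun t ht => (hZ t ht).2.continuousAt.continuousWithinAt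
  | succ n ih =>
    have h1 : ContDiffOn ℝ n (fun t => f (Z t)) I :=
      (hf.of_le (by exact_mod_cast le_top)).comp ih fun t ht => (hZ t ht).1
    push_cast
    refine (contDiffOn_succ_iff_deriv_of_isOpen hI).2 ⟨fun t ht =>
      (hZ t ht).2.differentiableAt.differentiableWithinAt, by simp, ?_⟩
    exact h1.congr fun t ht => (hZ t ht).2.deriv

/-- A solution through every point is what turns properties of trajectories into identities on open
sets, which can then be differentiated. The time interval is cut down by the preimage of `O`. -/
theorem exists_isSol [CompleteSpace E] {f : E → E} {O : Set E} (hO : IsOpen O)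
    (hf : ContDiffOn ℝ ∞ f O) {z : E} (hz : z ∈ O) :
    ∃ (I : Set ℝ) (Z : ℝ → E), IsOpen I ∧ (0 : ℝ) ∈ I ∧ Z 0 = z ∧ IsSol f O I Z := by
  obtain ⟨Z, h0, ε, hε, hd⟩ :=
    ((hf.contDiffAt (hO.mem_nhds hz)).of_le (n := ∞) (m := 1)
      (by exact_mod_cast le_top)).exists_forall_mem_closedBall_exists_eq_forall_mem_Ioo_hasDerivAt₀ 0
  have hc : ContinuousOn Z (Set.Ioo (0 - ε) (0 + ε)) := fun t ht =>
    (hd t ht).continuousAt.continuousWithinAt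
  refine ⟨Set.Ioo (0 - ε) (0 + ε) ∩ Z ⁻¹' O, Z, hc.isOpen_inter_preimage isOpen_Ioo hO,
    ⟨⟨by linarith, by linarith⟩, by simpa [h0] using hz⟩, h0, fun t ht => ⟨ht.2, hd t ht.1⟩⟩

/-- Linearization of the derivative along a vector field at a zero of the field. -/
theorem hasFDerivAt_lieD {f : E → E} {h : E → V} {O : Set E} (hO : IsOpen O)
    (hf : ContDiffOn ℝ ∞ f O) (hh : ContDiffOn ℝ ∞ h O) {z : E} (hz : z ∈ O) (h0 : f z = 0) :
    HasFDerivAt (lieD f h) (fderiv ℝ h z ∘L fderiv ℝ f z) z := by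
  have h1 := ((hh.fderiv_of_isOpen hO (m := ∞) (by simp)).hasFDerivAt_of_isOpen hO hz).clm_apply
    (hf.hasFDerivAt_of_isOpen hO hz)
  refine h1.congr_fderiv ?_
  ext e
  simp [h0]

/-- In the product rule the term with the second derivative of `h` is multiplied by `f z = 0`, so
each Lie derivative only contributes one more factor `fderiv ℝ f z`. -/
theorem fderiv_lieD_iterate {f : E → E} {h : E → V} {O : Set E} (hO : IsOpen O)
    (hf : ContDiffOn ℝ ∞ f O) (hh : ContDiffOn ℝ ∞ h O) {z : E} (hz : z ∈ O) (h0 : f z = 0)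
    (i : ℕ) (e : E) :
    fderiv ℝ ((lieD f)^[i] h) z e = fderiv ℝ h z ((fderiv ℝ f z)^[i] e) := by
  induction i generalizing e with
  | zero => rfl
  | succ i ih =>
    rw [Function.iterate_succ_apply',
      (hasFDerivAt_lieD hO hf (contDiffOn_lieD_iterate hO hf hh i) hz h0).fderiv,
      ContinuousLinearMap.comp_apply, ih, Function.iterate_succ_apply]

theorem lieD_iterate_eq_zero {f : E → E} {h : E → V} {z : E} (h0 : f z = 0) {i : ℕ} (hi : i ≠ 0) :
    (lieD f)^[i] h z = 0 := by
  obtain ⟨i, rfl⟩ := Nat.exists_eq_succ_of_ne_zero hi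
  rw [Function.iterate_succ_apply', lieD, h0, map_zero]

end VectorField

end

end LagrangianFlatness

namespace LagrangianFlatness

noncomputable section

/-! ### Finite jets, the formal time derivative, and the order of a function of jets. -/

section Jets

variable {m : ℕ}

/-- The `i`-th derivative in a jet, zero beyond the order of the jet. -/
def jetCoord (ρ m i : ℕ) : Jet ρ m →L[ℝ] Tup m :=
  if h : i < ρ + 1 then ContinuousLinearMap.proj (R := ℝ) (⟨i, h⟩ : Fin (ρ + 1)) else 0

theorem jetCoord_val {ρ : ℕ} (J : Jet ρ m) (i : Fin (ρ + 1)) : jetCoord ρ m i.val J = J i := by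
  rw [jetCoord, dif_pos i.isLt]; rfl

theorem jetCoord_of_lt {ρ i : ℕ} (J : Jet ρ m) (h : i < ρ + 1) : jetCoord ρ m i J = J ⟨i, h⟩ := by
  simp [jetCoord, h]

theorem jetCoord_of_ge {ρ i : ℕ} (J : Jet ρ m) (h : ρ + 1 ≤ i) : jetCoord ρ m i J = 0 := by
  simp [jetCoord, Nat.not_lt.2 h]

theorem jet_ext {ρ : ℕ} {J J' : Jet ρ m}
    (h : ∀ i ≤ ρ, jetCoord ρ m i J = jetCoord ρ m i J') : J = J' := by
  funext i
  rw [← jetCoord_val J, ← jetCoord_val J', h _ (by omega)]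

/-- Formal differentiation of jets; the top derivative is lost. -/
def jetShift (ρ m : ℕ) : Jet ρ m →L[ℝ] Jet ρ m :=
  ContinuousLinearMap.pi fun i => jetCoord ρ m (i.val + 1)

/-- The `r`-jet underlying a `ρ`-jet (extended by zero if `ρ < r`). -/
def jetTrunc (ρ r m : ℕ) : Jet ρ m →L[ℝ] Jet r m :=
  ContinuousLinearMap.pi fun i => jetCoord ρ m i.val

@[simp] theorem jetCoord_jetShift {ρ : ℕ} (i : ℕ) (J : Jet ρ m) :
    jetCoord ρ m i (jetShift ρ m J) = jetCoord ρ m (i + 1) J := by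
  rcases Nat.lt_or_ge i (ρ + 1) with h | h
  · rw [jetCoord_of_lt _ h]; rfl
  · rw [jetCoord_of_ge _ h, jetCoord_of_ge _ (by omega)]

theorem jetCoord_jetShift_iterate {ρ : ℕ} (i d : ℕ) (J : Jet ρ m) :
    jetCoord ρ m i ((jetShift ρ m)^[d] J) = jetCoord ρ m (i + d) J := by
  induction d generalizing i with
  | zero => rfl
  | succ d ih => rw [Function.iterate_succ_apply', jetCoord_jetShift, ih]; congr 2; ring

theorem jetCoord_jetTrunc {ρ r i : ℕ} (h : i ≤ r) (J : Jet ρ m) :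
    jetCoord r m i (jetTrunc ρ r m J) = jetCoord ρ m i J := by
  rw [jetCoord_of_lt _ (by omega)]; rfl

theorem jetCoord_constJet {ρ : ℕ} (i : ℕ) (c : Tup m) :
    jetCoord ρ m i (constJet ρ c) = if i = 0 then c else 0 := by
  rcases Nat.lt_or_ge i (ρ + 1) with h | h
  · rw [jetCoord_of_lt _ h]; rfl
  · rw [jetCoord_of_ge _ h, if_neg (by omega)]

theorem jetCoord_jetDir {ρ : ℕ} (i a : ℕ) (j : Fin m) :
    jetCoord ρ m a (jetDir ρ i j) = if a = i ∧ i ≤ ρ then Pi.single j 1 else 0 := by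
  rcases Nat.lt_or_ge a (ρ + 1) with h | h
  · rw [jetCoord_of_lt _ h]
    funext b
    by_cases h1 : a = i
    · subst h1
      simp [jetDir, Pi.single_apply, Nat.lt_succ_iff.1 h]
    · simp [jetDir, h1]
  · rw [jetCoord_of_ge _ h, if_neg (by omega)]

theorem jetCoord_jet {ρ i : ℕ} (h : i ≤ ρ) (c : ℝ → Tup m) (t : ℝ) :
    jetCoord ρ m i (jet ρ c t) = iteratedDeriv i c t := by
  rw [jetCoord_of_lt _ (by omega)]; rfl

@[simp] theorem jetShift_constJet {ρ : ℕ} (c : Tup m) : jetShift ρ m (constJet ρ c) = 0 :=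
  jet_ext fun i _ => by simp [jetCoord_constJet]

@[simp] theorem jetTrunc_constJet {ρ r : ℕ} (c : Tup m) :
    jetTrunc ρ r m (constJet ρ c) = constJet r c :=
  jet_ext fun i hi => by rw [jetCoord_jetTrunc hi, jetCoord_constJet, jetCoord_constJet]

theorem jetDir_of_lt {r i : ℕ} (h : r < i) (j : Fin m) : jetDir r i j = 0 :=
  jet_ext fun a _ => by rw [jetCoord_jetDir, if_neg (by omega), map_zero]

theorem jetTrunc_jetDir {ρ r : ℕ} (h : r ≤ ρ) (i : ℕ) (j : Fin m) :
    jetTrunc ρ r m (jetDir ρ i j) = jetDir r i j :=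
  jet_ext fun a ha => by
    rw [jetCoord_jetTrunc ha, jetCoord_jetDir, jetCoord_jetDir]
    exact if_congr ⟨by omega, by omega⟩ rfl rfl

theorem jetTrunc_jetShift_jetShift_jetDir {ρ r : ℕ} (h : r + 2 ≤ ρ) (i : ℕ) (j : Fin m) :
    jetTrunc ρ r m (jetShift ρ m (jetShift ρ m (jetDir ρ (i + 2) j))) = jetDir r i j :=
  jet_ext fun a ha => by
    rw [jetCoord_jetTrunc ha, jetCoord_jetShift, jetCoord_jetShift, jetCoord_jetDir,
      jetCoord_jetDir]
    exact if_congr ⟨by omega, by omega⟩ rfl rfl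

theorem jetShift_jetShift_jetDir_of_lt {ρ i : ℕ} (h : i < 2) (j : Fin m) :
    jetShift ρ m (jetShift ρ m (jetDir ρ i j)) = 0 :=
  jet_ext fun a ha => by
    rw [jetCoord_jetShift, jetCoord_jetShift, jetCoord_jetDir, if_neg (by omega), map_zero]

/-- The jets are spanned by the coordinate directions. -/
theorem jet_eq_sum {r : ℕ} (J : Jet r m) :
    J = ∑ i ∈ Finset.range (r + 1), ∑ j, jetCoord r m i J j • jetDir r i j := by
  refine jet_ext fun a ha => ?_
  simp only [map_sum, map_smul, jetCoord_jetDir]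
  rw [Finset.sum_eq_single_of_mem a (by simp; omega)]
  · funext b
    simp [ha, Finset.sum_apply, Pi.single_apply]
  · intro i _ hi
    simp [hi.symm]

theorem iteratedDeriv_jet_curve {ρ : ℕ} {J : ℝ → Jet ρ m} {I : Set ℝ} (hI : IsOpen I)
    (hJ : ∀ t ∈ I, HasDerivAt J (jetShift ρ m (J t)) t) (i : ℕ) {t : ℝ} (ht : t ∈ I) :
    iteratedDeriv i (fun s => J s 0) t = jetCoord ρ m i (J t) := by
  refine iteratedDeriv_eq_of_hasDerivAt (d := fun i s => jetCoord ρ m i (J s)) (n := i) hI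
    (fun s _ => by rw [jetCoord_of_lt _ (by omega)]; rfl) (fun j _ s hs => ?_) le_rfl t ht
  rw [← jetCoord_jetShift]
  exact (jetCoord ρ m j).hasFDerivAt.comp_hasDerivAt s (hJ s hs)

theorem jet_jet_curve {ρ r : ℕ} {J : ℝ → Jet ρ m} {I : Set ℝ} (hI : IsOpen I)
    (hJ : ∀ t ∈ I, HasDerivAt J (jetShift ρ m (J t)) t) {t : ℝ} (ht : t ∈ I) :
    jet r (fun s => J s 0) t = jetTrunc ρ r m (J t) := by
  refine jet_ext fun i hi => ?_
  rw [jetCoord_jet hi, jetCoord_jetTrunc hi, iteratedDeriv_jet_curve hI hJ i ht]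

theorem jetTrunc_self {ρ : ℕ} (J : Jet ρ m) : jetTrunc ρ ρ m J = J :=
  jet_ext fun _ hi => jetCoord_jetTrunc hi J

/-- A function of jets that does not depend on the derivatives of order above `a`. -/
def HasOrder {ρ : ℕ} {V : Type*} (a : ℕ) (H : Jet ρ m → V) : Prop :=
  ∀ J e, (∀ i ≤ a, jetCoord ρ m i e = 0) → H (J + e) = H J

theorem HasOrder.fderiv_apply {ρ a : ℕ} {V : Type*} [NormedAddCommGroup V] [NormedSpace ℝ V]
    {H : Jet ρ m → V} (hH : HasOrder a H) (J : Jet ρ m) {e : Jet ρ m}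
    (he : ∀ i ≤ a, jetCoord ρ m i e = 0) : fderiv ℝ H J e = 0 := by
  by_cases hd : DifferentiableAt ℝ H J
  · have h0 : HasDerivAt (fun s : ℝ => J + s • e) e 0 := by
      simpa using ((hasDerivAt_id (0 : ℝ)).smul_const e).const_add J
    have h1 : HasDerivAt (fun s : ℝ => H (J + s • e)) (fderiv ℝ H J e) 0 := by
      have h2 : HasFDerivAt H (fderiv ℝ H J) (J + (0 : ℝ) • e) := by
        simpa using hd.hasFDerivAt
      exact h2.comp_hasDerivAt 0 h0
    have h3 : (fun s : ℝ => H (J + s • e)) = fun _ => H J := by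
      funext s
      exact hH J _ fun i hi => by rw [map_smul, he i hi, smul_zero]
    rw [h3] at h1
    exact h1.unique (hasDerivAt_const 0 (H J))
  -- Here `fderiv` has its default value zero, so no smoothness assumption is needed.
  · rw [fderiv_zero_of_not_differentiableAt hd]; rfl

/-- Along a closed loop the curve of jets will be known to follow `jetShift` only below the top
order. This bound tells which Lie derivatives do not see the top order. -/
theorem HasOrder.lieD {ρ a : ℕ} {V : Type*} [NormedAddCommGroup V] [NormedSpace ℝ V]
    {H : Jet ρ m → V} (hH : HasOrder a H) : HasOrder (a + 1) (lieD (jetShift ρ m) H) := by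
  intro J e he
  have h1 : fderiv ℝ H (J + e) = fderiv ℝ H J := by
    rw [← fderiv_comp_add_right]
    congr 1
    funext K
    exact hH K e fun i hi => he i (by omega)
  have h2 : fderiv ℝ H J (jetShift ρ m e) = 0 :=
    hH.fderiv_apply J fun i hi => by rw [jetCoord_jetShift, he _ (by omega)]
  simp only [LagrangianFlatness.lieD]
  rw [h1, map_add, map_add, h2, add_zero]

theorem HasOrder.comp_jetTrunc {ρ r : ℕ} {V : Type*} (F : Jet r m → V) :
    HasOrder r fun J : Jet ρ m => F (jetTrunc ρ r m J) := by
  intro J e he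
  have : jetTrunc ρ r m e = 0 := jet_ext fun i hi => by
    rw [jetCoord_jetTrunc hi, he i hi, map_zero]
  simp only [map_add, this, add_zero]

end Jets

/-! ### The flat parameterization as identities between functions of jets. -/

section FlatJets

variable {m : ℕ} {S : LCSystem m} {qs : Cfg m} {us : Tup m}

namespace LCSystem.ConfigFlat

/-- The parameterization of the configuration, as a function of jets of arbitrary order. -/
def Fqr (P : S.ConfigFlat qs us) (ρ : ℕ) (J : Jet ρ m) : Cfg m := P.Fq (jetTrunc ρ P.r m J)

/-- The parameterization of the inputs, as a function of jets of arbitrary order. -/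
def Fur (P : S.ConfigFlat qs us) (ρ : ℕ) (J : Jet ρ m) : Tup m := P.Fu (jetTrunc ρ P.r m J)

/-- The jets of order `ρ` over the domain of the parameterization. -/
def dom (P : S.ConfigFlat qs us) (ρ : ℕ) : Set (Jet ρ m) := jetTrunc ρ P.r m ⁻¹' P.U

variable (P : S.ConfigFlat qs us) (ρ : ℕ)

theorem isOpen_dom : IsOpen (P.dom ρ) := P.isOpen_U.preimage (jetTrunc ρ P.r m).continuous

theorem constJet_mem_dom : constJet ρ (P.φ qs) ∈ P.dom ρ := by
  simpa [dom] using P.mem_U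

theorem contDiffOn_Fqr : ContDiffOn ℝ ∞ (P.Fqr ρ) (P.dom ρ) :=
  P.Fq_smooth.comp (jetTrunc ρ P.r m).contDiff.contDiffOn fun _ h => h

theorem contDiffOn_Fur : ContDiffOn ℝ ∞ (P.Fur ρ) (P.dom ρ) :=
  P.Fu_smooth.comp (jetTrunc ρ P.r m).contDiff.contDiffOn fun _ h => h

theorem contDiffOn_jetShift : ContDiffOn ℝ ∞ (jetShift ρ m) (P.dom ρ) :=
  (jetShift ρ m).contDiff.contDiffOn

/-- The system equations and the output equation hold identically for the parameterization. -/
theorem param_identities {J : Jet ρ m} (hJ : J ∈ P.dom ρ) :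
    P.Fqr ρ J ∈ S.Q ∧ P.φ (P.Fqr ρ J) = jetCoord ρ m 0 J ∧
      S.EqOfMotion (P.Fqr ρ J) (lieD (jetShift ρ m) (P.Fqr ρ) J)
        ((lieD (jetShift ρ m))^[2] (P.Fqr ρ) J) (P.Fur ρ J) := by
  -- An integral curve of the linear field `jetShift` consists of the jets of its own zeroth
  -- component. Thus `J` is the jet at time `0` of an actual output curve, to which `of_output`
  -- applies.
  obtain ⟨I, Z, hI, h0, rfl, hZ⟩ := exists_isSol (P.isOpen_dom ρ) (P.contDiffOn_jetShift ρ) hJ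
  have hd : ∀ t ∈ I, HasDerivAt Z (jetShift ρ m (Z t)) t := fun t ht => (hZ t ht).2
  have hj : ∀ t ∈ I, jet P.r (fun s => Z s 0) t = jetTrunc ρ P.r m (Z t) := fun t ht =>
    jet_jet_curve hI hd ht
  have hs : ContDiffOn ℝ ∞ (fun s => Z s 0) I :=
    contDiffOn_pi.1 (hZ.contDiffOn hI (P.contDiffOn_jetShift ρ)) 0
  obtain ⟨h1, h2⟩ := P.of_output I (fun s => Z s 0) hI hs fun t ht => by
    rw [hj t ht]; exact (hZ t ht).1
  have hq : (fun t => P.Fq (jet P.r (fun s => Z s 0) t)) =ᶠ[nhds 0] fun t => P.Fqr ρ (Z t) :=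
    Filter.eventuallyEq_of_mem (hI.mem_nhds h0) fun t ht => by simp only [hj t ht]; rfl
  have hm := h1.motion 0 h0
  have hmem := h1.mem 0 h0
  have h2 := h2 0 h0
  rw [hq.deriv_eq, hq.iteratedDeriv_eq,
    hZ.iteratedDeriv_comp (P.isOpen_dom ρ) hI (P.contDiffOn_jetShift ρ) (P.contDiffOn_Fqr ρ) 2 h0,
    (hZ.hasDerivAt_comp (P.isOpen_dom ρ) (P.contDiffOn_Fqr ρ) h0).deriv] at hm
  simp only [hj 0 h0] at hm hmem h2
  refine ⟨hmem, ?_, hm⟩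
  rw [jetCoord_of_lt _ (by omega)]
  exact h2

theorem hasOrder_Fqr : HasOrder P.r (P.Fqr ρ) := HasOrder.comp_jetTrunc P.Fq

theorem fderiv_Fqr (e : Jet ρ m) :
    fderiv ℝ (P.Fqr ρ) (constJet ρ (P.φ qs)) e =
      fderiv ℝ P.Fq (constJet P.r (P.φ qs)) (jetTrunc ρ P.r m e) := by
  have h : HasFDerivAt P.Fq (fderiv ℝ P.Fq (constJet P.r (P.φ qs)))
      (jetTrunc ρ P.r m (constJet ρ (P.φ qs))) := by
    rw [jetTrunc_constJet]
    exact P.Fq_smooth.hasFDerivAt_of_isOpen P.isOpen_U P.mem_U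
  have h2 := h.comp _ (jetTrunc ρ P.r m).hasFDerivAt
  rw [show P.Fqr ρ = P.Fq ∘ jetTrunc ρ P.r m from rfl, h2.fderiv]
  rfl

end LCSystem.ConfigFlat

theorem jet_const (r : ℕ) (c : Tup m) (t : ℝ) : jet r (fun _ => c) t = constJet r c := by
  funext i
  simp [jet, constJet, iteratedDeriv_const]

/-- Resting at the equilibrium is itself a trajectory, so it is recovered from its constant output.
-/
theorem LCSystem.ConfigFlat.param_constJet (hs : S.IsEquilibrium qs us) (P : S.ConfigFlat qs us) :
    P.Fq (constJet P.r (P.φ qs)) = qs ∧ P.Fu (constJet P.r (P.φ qs)) = us := by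
  obtain ⟨l, W, hW, hmem, h⟩ := P.of_trajectory
  have ht : S.IsTrajectory Set.univ (fun _ => qs) (fun _ => us) := by
    refine ⟨isOpen_univ, contDiffOn_const, contDiffOn_const, fun _ _ => hs.1, fun t _ => ?_⟩
    simpa [iteratedDeriv_const] using hs.2
  have := h Set.univ _ _ ht (fun t _ => by simpa [jet_const] using hmem) 0 trivial
  simp only [jet_const] at this
  exact ⟨this.2.1.symm, this.2.2.symm⟩

end FlatJets

end

end LagrangianFlatness

namespace LagrangianFlatness

noncomputable section

/-! ### Euler-Lagrange expressions and their linearization at rest. -/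

namespace LCSystem

variable {m : ℕ} (S : LCSystem m)

theorem g_symm {q : Cfg m} (hq : q ∈ S.Q) (i j : Fin (m + 1)) : S.g q i j = S.g q j i := by
  simpa using (S.g_posDef q hq).1.apply j i

theorem lagrangian_eq (q v : Cfg m) :
    S.lagrangian q v = (1 / 2) * ∑ i, ∑ j, S.g q i j * (v i * v j) - S.V q := by
  simp only [lagrangian, dotProduct, Matrix.mulVec, Finset.mul_sum]
  congr 1
  exact Finset.sum_congr rfl fun i _ => Finset.sum_congr rfl fun j _ => by ring

theorem hasFDerivAt_coord (i : Fin (m + 1)) (v : Cfg m) :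
    HasFDerivAt (fun v : Cfg m => v i)
      (ContinuousLinearMap.proj (R := ℝ) (φ := fun _ : Fin (m + 1) => ℝ) i) v :=
  (ContinuousLinearMap.proj (R := ℝ) (φ := fun _ : Fin (m + 1) => ℝ) i).hasFDerivAt

theorem momentum_eq {q : Cfg m} (hq : q ∈ S.Q) (v : Cfg m) (i : Fin (m + 1)) :
    S.momentum i (q, v) = ∑ j, S.g q i j * v j := by
  have h := ((HasFDerivAt.fun_sum (u := Finset.univ) fun i _ =>
    HasFDerivAt.fun_sum (u := Finset.univ) fun j _ =>
      ((hasFDerivAt_coord i v).fun_mul (hasFDerivAt_coord j v)).const_mul (S.g q i j)).const_mul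
        (1 / 2 : ℝ)).sub_const (S.V q)
  simp only [momentum, lagrangian_eq]
  rw [h.fderiv]
  simp only [smul_apply, sum_apply,
    add_apply, ContinuousLinearMap.proj_apply, smul_eq_mul, mul_add,
    Finset.sum_add_distrib, Pi.single_apply, mul_ite, mul_one, mul_zero, Finset.sum_ite_eq',
    Finset.mem_univ, if_true]
  -- The product rule yields two sums, equal by symmetry of `g`, which absorb the factor `1 / 2`.
  rw [Finset.sum_comm]
  simp only [Finset.sum_ite_eq', Finset.mem_univ, if_true]
  simp only [fun j => S.g_symm hq j i]
  ring

theorem hasFDerivAt_g {q : Cfg m} (hq : q ∈ S.Q) (i j : Fin (m + 1)) :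
    HasFDerivAt (fun q => S.g q i j) (fderiv ℝ (fun q => S.g q i j) q) q :=
  (S.g_smooth i j).hasFDerivAt_of_isOpen S.isOpen_Q hq

theorem eulerLagrange_eq {q : Cfg m} (hq : q ∈ S.Q) (v a : Cfg m) (i : Fin (m + 1)) :
    S.eulerLagrange q v a i =
      ∑ j, (S.g q i j * a j + v j * fderiv ℝ (fun q => S.g q i j) q v)
      - ((1 / 2) * ∑ k, ∑ j, v k * v j * fderiv ℝ (fun q => S.g q k j) q (Pi.single i 1)
        - fderiv ℝ S.V q (Pi.single i 1)) := by
  have hfst := hasFDerivAt_fst (𝕜 := ℝ) (p := (q, v))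
  have hsnd := hasFDerivAt_snd (𝕜 := ℝ) (p := (q, v))
  have hg := fun j => (S.hasFDerivAt_g hq i j).comp (q, v) hfst
  have hv := fun j => (hasFDerivAt_coord j v).comp (q, v) hsnd
  have h := HasFDerivAt.fun_sum (u := Finset.univ) fun j _ => (hg j).fun_mul (hv j)
  have h1 : S.momentum i =ᶠ[nhds (q, v)] fun x => ∑ j, S.g x.1 i j * x.2 j := by
    filter_upwards [(S.isOpen_Q.preimage continuous_fst).mem_nhds (x := (q, v)) hq] with x hx
    exact S.momentum_eq hx x.2 i
  have h2 := ((HasFDerivAt.fun_sum (u := Finset.univ) fun k _ =>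
    HasFDerivAt.fun_sum (u := Finset.univ) fun j _ =>
      (S.hasFDerivAt_g hq k j).mul_const (v k * v j)).const_mul (1 / 2 : ℝ)).fun_sub
      (S.V_smooth.hasFDerivAt_of_isOpen S.isOpen_Q hq)
  simp only [eulerLagrange, lagrangian_eq]
  rw [(h.congr_of_eventuallyEq h1).fderiv, h2.fderiv]
  simp

/-- At rest the Euler-Lagrange expression has no linear dependence on the velocity. -/
theorem exists_hasFDerivAt_eulerLagrange {q : Cfg m} (hq : q ∈ S.Q) (i : Fin (m + 1)) :
    ∃ (ν : Cfg m →L[ℝ] ℝ) (D : Cfg m × Cfg m × Cfg m →L[ℝ] ℝ),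
      HasFDerivAt (fun x : Cfg m × Cfg m × Cfg m => S.eulerLagrange x.1 x.2.1 x.2.2 i) D (q, 0, 0) ∧
        ∀ x, D x = ν x.1 + ∑ j, S.g q i j * x.2.2 j := by
  have hfst := hasFDerivAt_fst (𝕜 := ℝ) (p := (q, (0 : Cfg m), (0 : Cfg m)))
  have hsnd := hasFDerivAt_snd (𝕜 := ℝ) (p := (q, (0 : Cfg m), (0 : Cfg m)))
  have hv := hsnd.fst
  have ha := hsnd.snd
  have hvj := fun j => (hasFDerivAt_coord j (0 : Cfg m)).comp (q, 0, 0) hv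
  have haj := fun j => (hasFDerivAt_coord j (0 : Cfg m)).comp (q, 0, 0) ha
  have hg := fun k j => (S.hasFDerivAt_g hq k j).comp (q, 0, 0) hfst
  have hdg := fun k j =>
    (((S.g_smooth k j).fderiv_of_isOpen S.isOpen_Q (m := ∞)
      (by simp)).hasFDerivAt_of_isOpen S.isOpen_Q hq).comp (q, 0, 0) hfst
  have hdV :=
    ((S.V_smooth.fderiv_of_isOpen S.isOpen_Q (m := ∞)
      (by simp)).hasFDerivAt_of_isOpen S.isOpen_Q hq)
  have hdV' := (hdV.comp (q, 0, 0) hfst).clm_apply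
    (hasFDerivAt_const (Pi.single i 1 : Cfg m) (q, (0 : Cfg m), (0 : Cfg m)))
  have h := ((HasFDerivAt.fun_sum (u := Finset.univ) fun j _ =>
    ((hg i j).fun_mul (haj j)).fun_add ((hvj j).fun_mul ((hdg i j).clm_apply hv))).fun_sub
    (((HasFDerivAt.fun_sum (u := Finset.univ) fun k _ =>
      HasFDerivAt.fun_sum (u := Finset.univ) fun j _ =>
        ((hvj k).fun_mul (hvj j)).fun_mul ((hdg k j).clm_apply
          (hasFDerivAt_const (Pi.single i 1 : Cfg m)
            (q, (0 : Cfg m), (0 : Cfg m))))).const_mul (1 / 2 : ℝ)).fun_sub hdV'))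
  -- Terms in the velocity are quadratic, and the variation of `g` is multiplied by zero
  -- acceleration; only the Hessian of `V` and the inertia term survive.
  refine ⟨(ContinuousLinearMap.apply ℝ ℝ (Pi.single i 1 : Cfg m)).comp
    (fderiv ℝ (fderiv ℝ S.V) q), _, h.congr_of_eventuallyEq ?_, ?_⟩
  · filter_upwards [(S.isOpen_Q.preimage continuous_fst).mem_nhds
      (x := (q, (0 : Cfg m), (0 : Cfg m))) hq] with x hx
    rw [S.eulerLagrange_eq hx]
    rfl
  · intro x
    simp [add_comm]

end LCSystem

end

end LagrangianFlatness

namespace LagrangianFlatness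

noncomputable section

/-! ### Which derivatives of the output enter the linearized parameterization. -/

variable {m : ℕ}

/-- By `hC0` the kernel of `C` is a line, and it contains every `a i j` with `i ≠ 0`. Let `d` be the
highest order with a nonzero vector `b` there. The relation at order `d` gives `μ b = 0`, so `μ`
vanishes on the kernel. Then `ν b ≠ 0`, and `ν (a i j) = -μ (a (i - 2) j) = 0` for `i ≥ 3`, while
`h1` treats `i = 1`; these `a i j` are multiples of `b` and hence zero. -/
theorem columns_of_flat_relation {a : ℕ → Fin m → Cfg m} {C : Cfg m →ₗ[ℝ] Tup m}
    {μ ν : Cfg m →ₗ[ℝ] ℝ} (hC0 : ∀ j, C (a 0 j) = Pi.single j 1) (hC : ∀ i j, C (a (i + 1) j) = 0)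
    (h1 : ∀ j, ν (a 1 j) = 0)
    (h2 : ∀ i j, μ (a i j) + ν (a (i + 2) j) = 0) {r : ℕ} (hr : ∀ i > r, ∀ j, a i j = 0)
    (hμ : μ ≠ 0) :
    (∀ i, i ≠ 0 → i ≠ 2 → ∀ j, a i j = 0) ∧ ∃ b, ∀ j, ∃ c : ℝ, a 2 j = c • b := by
  by_cases hz : ∀ i, i ≠ 0 → ∀ j, a i j = 0
  · exact ⟨fun i hi _ => hz i hi, 0, fun j => ⟨0, by simp [hz 2]⟩⟩
  push Not at hz
  obtain ⟨i₀, hi₀, j₀, hij⟩ := hz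
  have hsurj : Function.Surjective C := by
    intro y
    refine ⟨∑ j, y j • a 0 j, ?_⟩
    simp only [map_sum, map_smul, hC0]
    funext b
    simp [Finset.sum_apply, Pi.single_apply]
  have hker : Module.finrank ℝ (LinearMap.ker C) = 1 := by
    have := LinearMap.finrank_range_add_finrank_ker C
    rw [LinearMap.range_eq_top.2 hsurj, finrank_top] at this
    simp only [Module.finrank_fintype_fun_eq_card, Fintype.card_fin] at this
    omega
  have hmem : ∀ i, i ≠ 0 → ∀ j, C (a i j) = 0 := by
    intro i hi j
    obtain ⟨i, rfl⟩ := Nat.exists_eq_succ_of_ne_zero hi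
    exact hC i j
  classical
  have hbdd : ∀ i, (i ≠ 0 ∧ ∃ j, a i j ≠ 0) → i ≤ r := by
    rintro i ⟨_, j, hj⟩
    by_contra hlt
    exact hj (hr i (by omega) j)
  have hd := Nat.findGreatest_spec (P := fun i => i ≠ 0 ∧ ∃ j, a i j ≠ 0)
    (hbdd i₀ ⟨hi₀, j₀, hij⟩) ⟨hi₀, j₀, hij⟩
  have hmax : ∀ i, Nat.findGreatest (fun i => i ≠ 0 ∧ ∃ j, a i j ≠ 0) r < i → ∀ j, a i j = 0 := by
    intro i hi j
    by_contra hne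
    have hP : i ≠ 0 ∧ ∃ j, a i j ≠ 0 := ⟨by omega, j, hne⟩
    exact absurd (Nat.le_findGreatest (P := fun i => i ≠ 0 ∧ ∃ j, a i j ≠ 0) (hbdd i hP) hP)
      (by omega)
  generalize Nat.findGreatest (fun i => i ≠ 0 ∧ ∃ j, a i j ≠ 0) r = d at hd hmax
  obtain ⟨hd0, j₁, hb⟩ := hd
  have hspan : ∀ x, C x = 0 → ∃ c : ℝ, x = c • a d j₁ := by
    intro x hx
    obtain ⟨c, hc⟩ := (finrank_eq_one_iff_of_nonzero' (⟨a d j₁, hmem d hd0 j₁⟩ : LinearMap.ker C)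
      (by simpa [Subtype.ext_iff] using hb)).1 hker ⟨x, hx⟩
    exact ⟨c, (congrArg Subtype.val hc).symm⟩
  have hμb : μ (a d j₁) = 0 := by
    have := h2 d j₁
    rwa [hmax (d + 2) (by omega), map_zero, add_zero] at this
  have hμi : ∀ i, i ≠ 0 → ∀ j, μ (a i j) = 0 := by
    intro i hi j
    obtain ⟨c, hc⟩ := hspan _ (hmem i hi j)
    rw [hc, map_smul, hμb, smul_zero]
  -- Otherwise `ν` kills every `a 2 j`, so `μ` kills every `a 0 j` as well as `b`; these span the
  -- whole space, contradicting `hμ`.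
  have hνb : ν (a d j₁) ≠ 0 := by
    intro hνb
    apply hμ
    have hμ0 : ∀ j, μ (a 0 j) = 0 := by
      intro j
      obtain ⟨c, hc⟩ := hspan _ (hmem 2 (by norm_num) j)
      have := h2 0 j
      rwa [hc, map_smul, hνb, smul_zero, add_zero] at this
    refine LinearMap.ext fun x => ?_
    obtain ⟨c, hc⟩ := hspan (x - ∑ j, C x j • a 0 j) (by
      simp only [map_sub, map_sum, map_smul, hC0]
      funext b
      simp [Finset.sum_apply, Pi.single_apply])
    rw [sub_eq_iff_eq_add.1 hc]
    simp [hμb, hμ0]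
  refine ⟨fun i hi0 hi2 j => ?_, a d j₁, fun j => hspan _ (hmem 2 (by norm_num) j)⟩
  obtain ⟨c, hc⟩ := hspan _ (hmem i hi0 j)
  have hν : ν (a i j) = 0 := by
    rcases Nat.lt_or_ge i 2 with h | h
    · rw [show i = 1 by omega]; exact h1 j
    · obtain ⟨l, rfl⟩ := Nat.exists_eq_add_of_le' h
      have := h2 l j
      rwa [hμi l (by omega), zero_add] at this
  rw [hc, map_smul, smul_eq_mul, mul_eq_zero, or_iff_left hνb] at hν
  rw [hc, hν, zero_smul]

namespace LCSystem.ConfigFlat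

variable {S : LCSystem m} {qs : Cfg m} {us : Tup m}

theorem exists_annihilator (G : Matrix (Fin (m + 1)) (Fin m) ℝ) :
    ∃ n : Cfg m, n ≠ 0 ∧ ∀ j, ∑ i, n i * G i j = 0 := by
  have h := LinearMap.ker_ne_bot_of_finrank_lt (f := G.vecMulLinear) (by simp)
  obtain ⟨n, hn, hn0⟩ := (Submodule.ne_bot_iff _).1 h
  exact ⟨n, hn0, fun j => congrFun (LinearMap.mem_ker.1 hn) j⟩

/-- The linearization of the parameterization at the equilibrium only involves the outputs and
their second derivatives, and the second derivatives only in a single direction. -/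
theorem columns (hs : S.IsEquilibrium qs us) (P : S.ConfigFlat qs us) :
    (∀ i, i ≠ 0 → i ≠ 2 → ∀ j,
      fderiv ℝ P.Fq (constJet P.r (P.φ qs)) (jetDir P.r i j) = 0) ∧
    ∃ b, ∀ j, ∃ c : ℝ, fderiv ℝ P.Fq (constJet P.r (P.φ qs)) (jetDir P.r 2 j) = c • b := by
  obtain ⟨n, hn0, hn⟩ := exists_annihilator (S.G qs)
  -- Two extra orders leave room for two formal derivatives of an `r`-jet.
  set ρ := P.r + 2 with hρ
  set A := fderiv ℝ P.Fq (constJet P.r (P.φ qs)) with hA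
  have hO := P.isOpen_dom ρ
  have hc := P.constJet_mem_dom ρ
  have hsh := P.contDiffOn_jetShift ρ
  have hF := P.contDiffOn_Fqr ρ
  obtain ⟨hq0, hu0⟩ := P.param_constJet hs
  have hFc : P.Fqr ρ (constJet ρ (P.φ qs)) = qs := by simpa [Fqr] using hq0
  have hUc : P.Fur ρ (constJet ρ (P.φ qs)) = us := by simpa [Fur] using hu0
  have hs0 : jetShift ρ m (constJet ρ (P.φ qs)) = 0 := jetShift_constJet _
  have hv0 : lieD (jetShift ρ m) (P.Fqr ρ) (constJet ρ (P.φ qs)) = 0 :=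
    lieD_iterate_eq_zero (i := 1) hs0 one_ne_zero
  have ha0 : (lieD (jetShift ρ m))^[2] (P.Fqr ρ) (constJet ρ (P.φ qs)) = 0 :=
    lieD_iterate_eq_zero hs0 two_ne_zero
  have hDi : ∀ i, HasFDerivAt ((lieD (jetShift ρ m))^[i] (P.Fqr ρ)) _ (constJet ρ (P.φ qs)) :=
    fun i => (contDiffOn_lieD_iterate hO hsh hF i).hasFDerivAt_of_isOpen hO hc
  have hDe : ∀ i e, fderiv ℝ ((lieD (jetShift ρ m))^[i] (P.Fqr ρ)) (constJet ρ (P.φ qs)) e =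
      A (jetTrunc ρ P.r m ((jetShift ρ m)^[i] e)) := by
    intro i e
    rw [fderiv_lieD_iterate hO hsh hF hc hs0, (jetShift ρ m).fderiv, P.fderiv_Fqr]
  choose ν D hD hDν using S.exists_hasFDerivAt_eulerLagrange hs.1
  -- the output equation
  have hC : ∀ e : Jet ρ m, fderiv ℝ P.φ qs (A (jetTrunc ρ P.r m e)) = jetCoord ρ m 0 e := by
    intro e
    have h1 : HasFDerivAt P.φ (fderiv ℝ P.φ qs) (P.Fqr ρ (constJet ρ (P.φ qs))) := by
      rw [hFc]; exact P.φ_smooth.hasFDerivAt_of_isOpen S.isOpen_Q hs.1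
    have h2 := h1.comp _ (hDi 0)
    have h3 : (fun J => P.φ (P.Fqr ρ J)) =ᶠ[nhds (constJet ρ (P.φ qs))] jetCoord ρ m 0 :=
      Filter.eventuallyEq_of_mem (hO.mem_nhds hc) fun J hJ => (P.param_identities ρ hJ).2.1
    have h4 := (jetCoord ρ m 0).hasFDerivAt.unique (h2.congr_of_eventuallyEq h3.symm)
    rw [h4, ContinuousLinearMap.comp_apply, hDe]
    rfl
  -- the underactuated equation
  have hE : ∀ e : Jet ρ m,
      (∑ i, n i * ∑ j, S.g qs i j *
          A (jetTrunc ρ P.r m (jetShift ρ m (jetShift ρ m e))) j) +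
        ((∑ i, n i * ν i (A (jetTrunc ρ P.r m e))) -
          ∑ i, n i * ∑ j, us j * fderiv ℝ (fun q => S.G q i j) qs (A (jetTrunc ρ P.r m e))) = 0 := by
    intro e
    have hx := (hDi 0).prodMk ((hDi 1).prodMk (hDi 2))
    have hDc : ∀ i, HasFDerivAt (fun x : Cfg m × Cfg m × Cfg m =>
        S.eulerLagrange x.1 x.2.1 x.2.2 i) (D i)
        (P.Fqr ρ (constJet ρ (P.φ qs)), lieD (jetShift ρ m) (P.Fqr ρ) (constJet ρ (P.φ qs)),
          (lieD (jetShift ρ m))^[2] (P.Fqr ρ) (constJet ρ (P.φ qs))) := by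
      intro i
      rw [hFc, hv0, ha0]; exact hD i
    have hl := HasFDerivAt.fun_sum (u := Finset.univ) fun i _ =>
      (HasFDerivAt.comp (constJet ρ (P.φ qs)) (hDc i) hx).const_mul (n i)
    have hG : ∀ i j, HasFDerivAt (fun q => S.G q i j) (fderiv ℝ (fun q => S.G q i j) qs)
        (P.Fqr ρ (constJet ρ (P.φ qs))) := by
      intro i j
      rw [hFc]; exact (S.G_smooth i j).hasFDerivAt_of_isOpen S.isOpen_Q hs.1
    have hu := (P.contDiffOn_Fur ρ).hasFDerivAt_of_isOpen hO hc
    have huj := hasFDerivAt_pi'.1 hu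
    have hGF := fun i j => ((hG i j).comp _ (hDi 0)).fun_mul (huj j)
    have hGs := fun i => HasFDerivAt.fun_sum (u := Finset.univ) fun j _ => hGF i j
    have hr := HasFDerivAt.fun_sum (u := Finset.univ) fun i _ => (hGs i).const_mul (n i)
    have heq := (hl.unique (hr.congr_of_eventuallyEq
      (Filter.eventuallyEq_of_mem (hO.mem_nhds hc) fun J hJ => by
        refine Finset.sum_congr rfl fun i _ => ?_
        exact congrArg (n i * ·) ((P.param_identities ρ hJ).2.2 i))))
    have heq := DFunLike.congr_fun heq e
    simp only [sum_apply, smul_apply, ContinuousLinearMap.comp_apply, hDν,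
      ContinuousLinearMap.prod_apply, smul_eq_mul, add_apply, Function.comp_apply,
      Function.iterate_zero, id_eq, hFc, hUc, ContinuousLinearMap.proj_apply,
      Function.iterate_succ, mul_add, Finset.sum_add_distrib] at heq
    -- The variation of the inputs drops out; the variation of `G` times `us` remains and becomes
    -- part of `ν'`.
    have hz : ∑ i, n i * ∑ j, S.G qs i j *
        fderiv ℝ (P.Fur ρ) (constJet ρ (P.φ qs)) e j = 0 := by
      simp only [Finset.mul_sum, ← mul_assoc]
      rw [Finset.sum_comm]
      simp only [← Finset.sum_mul, hn, zero_mul, Finset.sum_const_zero]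
    have hDe0 : fderiv ℝ (P.Fqr ρ) (constJet ρ (P.φ qs)) e = A (jetTrunc ρ P.r m e) := hDe 0 e
    have hDe2 : fderiv ℝ (lieD (jetShift ρ m) (lieD (jetShift ρ m) (P.Fqr ρ)))
        (constJet ρ (P.φ qs)) e = A (jetTrunc ρ P.r m (jetShift ρ m (jetShift ρ m e))) := hDe 2 e
    rw [hz, hDe0, hDe2] at heq
    linarith
  let μ : Cfg m →ₗ[ℝ] ℝ := ∑ i, n i • ∑ j, S.g qs i j • LinearMap.proj j
  let ν' : Cfg m →ₗ[ℝ] ℝ := (∑ i, n i • (ν i).toLinearMap) -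
    ∑ i, n i • ∑ j, us j • (fderiv ℝ (fun q => S.G q i j) qs).toLinearMap
  have hE' : ∀ e : Jet ρ m, μ (A (jetTrunc ρ P.r m (jetShift ρ m (jetShift ρ m e)))) +
      ν' (A (jetTrunc ρ P.r m e)) = 0 := by
    intro e
    simpa [μ, ν', LinearMap.sum_apply] using hE e
  have hCd : ∀ i j, fderiv ℝ P.φ qs (A (jetDir P.r i j)) =
      if 0 = i ∧ i ≤ ρ then Pi.single j 1 else 0 := by
    intro i j
    rw [← jetCoord_jetDir, ← hC, jetTrunc_jetDir (by omega)]
  have hν : ∀ j, ν' (A (jetDir P.r 1 j)) = 0 := by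
    intro j
    have := hE' (jetDir ρ 1 j)
    rwa [jetShift_jetShift_jetDir_of_lt one_lt_two, map_zero, map_zero, map_zero, zero_add,
      jetTrunc_jetDir (by omega)] at this
  refine columns_of_flat_relation (a := fun i j => A (jetDir P.r i j))
    (C := (fderiv ℝ P.φ qs).toLinearMap) (μ := μ) (ν := ν') (r := P.r)
    (fun j => by simp [hCd]) (fun i j => by simp [hCd]) hν
    (fun i j => ?_) (fun i hi j => by simp [jetDir_of_lt hi]) fun hμ => ?_
  · have := hE' (jetDir ρ (i + 2) j)
    rwa [jetTrunc_jetShift_jetShift_jetDir le_rfl, jetTrunc_jetDir (by omega)] at this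
  -- `μ` is `x ↦ nᵀ g x`, so its value at `n` itself is positive.
  · have hpos := (S.g_posDef qs hs.1).dotProduct_mulVec_pos hn0
    have h0 := LinearMap.congr_fun hμ n
    simp only [μ, LinearMap.sum_apply, LinearMap.smul_apply, LinearMap.proj_apply, smul_eq_mul,
      LinearMap.zero_apply] at h0
    simp only [dotProduct, Matrix.mulVec, star_trivial] at hpos
    exact absurd h0 hpos.ne'

end LCSystem.ConfigFlat

end

end LagrangianFlatness

namespace LagrangianFlatness

noncomputable section

/-! ### The linearized state map, and its inversion by a linearized closed loop. -/

variable {m : ℕ}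

namespace LCSystem.ConfigFlat

variable {S : LCSystem m} {qs : Cfg m} {us : Tup m}

theorem jac_eq_zero (hs : S.IsEquilibrium qs us) (P : S.ConfigFlat qs us) (k : ℕ) {i : ℕ}
    (h0 : i ≠ 0) (h2 : i ≠ 2) : P.jac k i = 0 := by
  ext a j
  simp [jac, (P.columns hs).1 i h0 h2 j]

theorem exists_jac_two_eq (hs : S.IsEquilibrium qs us) (P : S.ConfigFlat qs us) (k : ℕ) :
    ∃ (b : StIdx m k → ℝ) (c : Fin m → ℝ), P.jac k 2 = Matrix.vecMulVec b c := by
  obtain ⟨b, hb⟩ := (P.columns hs).2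
  choose c hc using hb
  refine ⟨statePart k b, c, ?_⟩
  ext a j
  simp [jac, hc, Matrix.vecMulVec_apply, statePart, mul_comm]

theorem jac_of_lt (P : S.ConfigFlat qs us) (k : ℕ) {i : ℕ} (h : P.r < i) : P.jac k i = 0 := by
  ext a j
  simp [jac, jetDir_of_lt h]

theorem statePart_fderiv (hs : S.IsEquilibrium qs us) (P : S.ConfigFlat qs us) (k : ℕ)
    (η : ℕ → Tup m) :
    statePart k (fderiv ℝ P.Fq (constJet P.r (P.φ qs)) fun i => η i.val) =
      (P.jac k 0).mulVec (η 0) + (P.jac k 2).mulVec (η 2) := by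
  have hη : ∀ i ∈ Finset.range (P.r + 1), jetCoord P.r m i (fun i => η i.val) = η i := by
    intro i hi
    rw [jetCoord_of_lt _ (Finset.mem_range.1 hi)]
  have h1 : statePart k (fderiv ℝ P.Fq (constJet P.r (P.φ qs)) fun i => η i.val) =
      ∑ i ∈ Finset.range (P.r + 1), (P.jac k i).mulVec (η i) := by
    rw [jet_eq_sum (fun i => η i.val)]
    simp only [map_sum, map_smul]
    funext a
    simp only [statePart, Finset.sum_apply, Pi.smul_apply, smul_eq_mul, Matrix.mulVec, dotProduct]
    refine Finset.sum_congr rfl fun i hi => Finset.sum_congr rfl fun j _ => ?_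
    rw [hη i hi, mul_comm]
    rfl
  -- Padding by zero matrices makes the index `2` available even if `r < 2`.
  have h2 : ∑ i ∈ Finset.range (P.r + 1), (P.jac k i).mulVec (η i) =
      ∑ i ∈ Finset.range (P.r + 3), (P.jac k i).mulVec (η i) := by
    refine Finset.sum_subset (by intro i; simp; omega) fun i _ hi => ?_
    rw [P.jac_of_lt k (by simpa using hi), Matrix.zero_mulVec]
  have h3 : ∑ i ∈ Finset.range (P.r + 3), (P.jac k i).mulVec (η i) =
      ∑ i ∈ ({0, 2} : Finset ℕ), (P.jac k i).mulVec (η i) := by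
    symm
    refine Finset.sum_subset (by intro i; simp; omega) fun i _ hi => ?_
    simp only [Finset.mem_insert, Finset.mem_singleton, not_or] at hi
    rw [P.jac_eq_zero hs k hi.1 hi.2, Matrix.zero_mulVec]
  rw [h1, h2, h3, Finset.sum_pair (by norm_num)]

end LCSystem.ConfigFlat

/-- The sequence of derivatives of an output, given by those of component `j` of order less than
`κ j`, the others being zero. -/
def extend (κ : Fin m → ℕ) (i : ℕ) : ((Σ j, Fin (κ j)) → ℝ) →ₗ[ℝ] Tup m :=
  LinearMap.pi fun j => if h : i < κ j then LinearMap.proj ⟨j, ⟨i, h⟩⟩ else 0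

theorem extend_of_lt {κ : Fin m → ℕ} {i : ℕ} {j : Fin m} (h : i < κ j)
    (x : (Σ j, Fin (κ j)) → ℝ) : extend κ i x j = x ⟨j, ⟨i, h⟩⟩ := by
  simp [extend, h]

theorem extend_of_le {κ : Fin m → ℕ} {i : ℕ} {j : Fin m} (h : κ j ≤ i)
    (x : (Σ j, Fin (κ j)) → ℝ) : extend κ i x j = 0 := by
  simp [extend, Nat.not_lt.2 h]

/-- The linearized dependence of the generalized state on the derivatives of the output of order
less than `κ`. -/
def stateMap {ι : Type} (M₀ M₂ : Matrix ι (Fin m) ℝ) (κ : Fin m → ℕ) :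
    ((Σ j, Fin (κ j)) → ℝ) →ₗ[ℝ] (ι → ℝ) × (ι → ℝ) :=
  (M₀.mulVecLin ∘ₗ extend κ 0 + M₂.mulVecLin ∘ₗ extend κ 2).prod
    (M₀.mulVecLin ∘ₗ extend κ 1 + M₂.mulVecLin ∘ₗ extend κ 3)

theorem stateMap_apply {ι : Type} (M₀ M₂ : Matrix ι (Fin m) ℝ) (κ : Fin m → ℕ)
    (x : (Σ j, Fin (κ j)) → ℝ) :
    stateMap M₀ M₂ κ x = (M₀.mulVec (extend κ 0 x) + M₂.mulVec (extend κ 2 x),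
      M₀.mulVec (extend κ 1 x) + M₂.mulVec (extend κ 3 x)) := rfl

/-- Here `A` is the linearized closed loop and `η` the linearized output. With zero input jet,
derivatives of order at least `κ` vanish, so reading off the lower ones gives a right inverse `a` of
`stateMap`. Injectivity follows once `a` is shown to be onto, which uses that the inputs reach all
derivatives independently. -/
theorem stateMap_bijective_of_linear {ι : Type} {N : ℕ} {M₀ M₂ : Matrix ι (Fin m) ℝ}
    {κ : Fin m → ℕ}
    (A : ((ι → ℝ) × (ι → ℝ) × Jet N m) →ₗ[ℝ] ((ι → ℝ) × (ι → ℝ) × Jet N m))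
    (η : ((ι → ℝ) × (ι → ℝ) × Jet N m) →ₗ[ℝ] Tup m)
    (hv : ∀ z, (A z).1 = z.2.1) (hJ : ∀ z, (A z).2.2 = jetShift N m z.2.2)
    (hw : ∀ z j, η (A^[κ j] z) j = jetCoord N m 0 z.2.2 j)
    (hq : ∀ z, z.1 = M₀.mulVec (η z) + M₂.mulVec (η (A^[2] z))) :
    Function.Bijective (stateMap M₀ M₂ κ) := by
  have hJi : ∀ i z, (A^[i] z).2.2 = (jetShift N m)^[i] z.2.2 := by
    intro i z
    induction i with
    | zero => rfl
    | succ i ih => rw [Function.iterate_succ_apply', Function.iterate_succ_apply', hJ, ih]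
  have hwi : ∀ i z j, κ j ≤ i → η (A^[i] z) j = jetCoord N m (i - κ j) z.2.2 j := by
    intro i z j h
    rw [← Nat.add_sub_cancel' h, Function.iterate_add_apply, hw, hJi, jetCoord_jetShift_iterate]
    simp
  let F : ((ι → ℝ) × (ι → ℝ) × Jet N m) →ₗ[ℝ] ((Σ j, Fin (κ j)) → ℝ) :=
    LinearMap.pi fun p => LinearMap.proj p.1 ∘ₗ η ∘ₗ (A ^ p.2.val)
  have hF : ∀ z p, F z p = η (A^[p.2.val] z) p.1 := fun z p => by
    simp [F, Module.End.pow_apply]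
  let a : ((ι → ℝ) × (ι → ℝ)) →ₗ[ℝ] ((Σ j, Fin (κ j)) → ℝ) :=
    F ∘ₗ (LinearMap.fst ℝ _ _).prod ((LinearMap.snd ℝ _ _).prod 0)
  have ha : ∀ x, a x = F (x.1, x.2, 0) := fun x => rfl
  have hext : ∀ x i, extend κ i (a x) = η (A^[i] (x.1, x.2, 0)) := by
    intro x i
    funext j
    rcases Nat.lt_or_ge i (κ j) with h | h
    · rw [extend_of_lt h, ha, hF]
    · rw [extend_of_le h, hwi _ _ _ h, map_zero]; rfl
  have hTa : ∀ x, stateMap M₀ M₂ κ (a x) = x := by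
    intro x
    rw [stateMap_apply, hext, hext, hext, hext]
    refine Prod.ext (hq (x.1, x.2, 0)).symm ?_
    exact ((hv _).symm.trans (hq (A (x.1, x.2, 0)))).symm
  have hsurj : LinearMap.range a = ⊤ := by
    by_contra hne
    obtain ⟨f, hf, hle⟩ := Submodule.exists_le_ker_of_lt_top _ (lt_top_iff_ne_top.2 hne)
    classical
    have hfs : ∀ x, f x = ∑ p, f (Pi.single p 1) * x p := by
      intro x
      conv_lhs => rw [pi_eq_sum_univ' x]
      simp [map_sum, mul_comm, Pi.single]
    have hfa : ∀ z, z.2.2 = 0 → f (F z) = 0 := by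
      rintro ⟨x, y, w⟩ rfl
      exact hle ⟨(x, y), rfl⟩
    have hex : (Finset.univ.filter fun p => f (Pi.single p 1) ≠ 0).Nonempty := by
      by_contra hemp
      rw [Finset.not_nonempty_iff_eq_empty, Finset.filter_eq_empty_iff] at hemp
      refine hf (LinearMap.ext fun x => ?_)
      rw [hfs]
      exact Finset.sum_eq_zero fun p hp => by
        rw [not_not.1 (hemp hp), zero_mul]
    -- Among the coordinates seen by `f`, the one farthest below its input: maximality ensures that,
    -- after the same number of steps, all the others have reached order `κ` or more, where they are
    -- read off from the input jet.
    obtain ⟨p, hp, hmax⟩ := Finset.exists_max_image _ (fun p => κ p.1 - p.2.val) hex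
    simp only [Finset.mem_filter, Finset.mem_univ, true_and] at hp hmax
    have hplt := p.2.isLt
    -- At least one shift has removed the unit input, so this vector has zero input jet and `f`
    -- vanishes on its image. Yet its only contribution to `f` is the coefficient at `p`.
    have h0 := hfa (A^[κ p.1 - p.2.val] (0, 0, jetDir N 0 p.1)) (by
      rw [hJi]
      refine jet_ext fun i _ => ?_
      rw [jetCoord_jetShift_iterate, jetCoord_jetDir, if_neg (by omega), map_zero])
    rw [hfs, Finset.sum_eq_single p, hF, ← Function.iterate_add_apply,
      hwi _ _ _ (by omega)] at h0
    · rw [show p.2.val + (κ p.1 - p.2.val) - κ p.1 = 0 by omega, jetCoord_jetDir] at h0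
      simp at h0
      exact hp h0
    · intro p' _ hne
      by_cases h : f (Pi.single p' 1) = 0
      · rw [h, zero_mul]
      · have hle := hmax p' h
        have hp'lt := p'.2.isLt
        rw [hF, ← Function.iterate_add_apply, hwi _ _ _ (by omega), jetCoord_jetDir]
        by_cases hi : p'.2.val + (κ p.1 - p.2.val) - κ p'.1 = 0
        · have hj : p'.1 ≠ p.1 := by
            intro hj
            apply hne
            obtain ⟨j, i⟩ := p
            obtain ⟨j', i'⟩ := p'
            obtain rfl : j' = j := hj
            congr 1
            apply Fin.ext
            dsimp only at hi hplt hp'lt hle ⊢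
            omega
          simp [hi, hj]
        · simp [hi]
    · simp
  refine ⟨?_, fun x => ⟨a x, hTa x⟩⟩
  intro x y hxy
  obtain ⟨x, rfl⟩ := LinearMap.range_eq_top.1 hsurj x
  obtain ⟨y, rfl⟩ := LinearMap.range_eq_top.1 hsurj y
  rw [hTa, hTa] at hxy
  rw [hxy]

end

end LagrangianFlatness

namespace LagrangianFlatness

noncomputable section

/-! ### Linear algebra: admissible multi-indices and rank conditions. -/

variable {m : ℕ} {ι : Type}

/-- The columns of `M₀` in `s` and those of `M₂` in `t` span. -/
def ColsSpan (M₀ M₂ : Matrix ι (Fin m) ℝ) (s t : Finset (Fin m)) : Prop :=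
  ∀ x, ∃ y z : Tup m, (∀ j ∉ s, y j = 0) ∧ (∀ j ∉ t, z j = 0) ∧ M₀.mulVec y + M₂.mulVec z = x

/-- The components of order at least `a`. -/
def level (κ : Fin m → ℕ) (a : ℕ) : Finset (Fin m) := Finset.univ.filter fun j => a ≤ κ j

@[simp] theorem mem_level {κ : Fin m → ℕ} {a : ℕ} {j : Fin m} : j ∈ level κ a ↔ a ≤ κ j := by
  simp [level]

theorem extend_eq_zero {κ : Fin m → ℕ} {i : ℕ} (x : (Σ j, Fin (κ j)) → ℝ) :
    ∀ j ∉ level κ (i + 1), extend κ i x j = 0 := by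
  intro j hj
  exact extend_of_le (by simpa using hj) x

theorem extend_of_seq {κ : Fin m → ℕ} (Y : ℕ → Tup m) {i : ℕ}
    (hY : ∀ j ∉ level κ (i + 1), Y i j = 0) :
    extend κ i (fun p : Σ j, Fin (κ j) => Y p.2.val p.1) = Y i := by
  funext j
  rcases Nat.lt_or_ge i (κ j) with h | h
  · rw [extend_of_lt h]
  · rw [extend_of_le h, hY]; simpa using h

/-- Configurations involve only the orders `0` and `2`, velocities only `1` and `3`, so the two
blocks decouple. -/
theorem stateMap_surjective_iff {M₀ M₂ : Matrix ι (Fin m) ℝ} {κ : Fin m → ℕ} :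
    Function.Surjective (stateMap M₀ M₂ κ) ↔
      ColsSpan M₀ M₂ (level κ 1) (level κ 3) ∧ ColsSpan M₀ M₂ (level κ 2) (level κ 4) := by
  constructor
  · intro h
    constructor <;> intro x
    · obtain ⟨y, hy⟩ := h (x, 0)
      exact ⟨extend κ 0 y, extend κ 2 y, extend_eq_zero y, extend_eq_zero y, congrArg Prod.fst hy⟩
    · obtain ⟨y, hy⟩ := h (0, x)
      exact ⟨extend κ 1 y, extend κ 3 y, extend_eq_zero y, extend_eq_zero y, congrArg Prod.snd hy⟩
  · rintro ⟨h1, h2⟩ ⟨x₁, x₂⟩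
    obtain ⟨y₀, y₂, h0, h2', rfl⟩ := h1 x₁
    obtain ⟨y₁, y₃, h1', h3, rfl⟩ := h2 x₂
    let Y : ℕ → Tup m := fun i =>
      if i = 0 then y₀ else if i = 1 then y₁ else if i = 2 then y₂ else y₃
    refine ⟨fun p => Y p.2.val p.1, ?_⟩
    rw [stateMap_apply, extend_of_seq Y (i := 0) h0, extend_of_seq Y (i := 1) h1',
      extend_of_seq Y (i := 2) h2', extend_of_seq Y (i := 3) h3]
    rfl

theorem ColsSpan.card_le [Fintype ι] {M₀ M₂ : Matrix ι (Fin m) ℝ} {s t : Finset (Fin m)}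
    (h : ColsSpan M₀ M₂ s t) : Fintype.card ι ≤ s.card + t.card := by
  let e : ∀ s : Finset (Fin m), (s → ℝ) →ₗ[ℝ] Tup m := fun s =>
    LinearMap.pi fun j => if hj : j ∈ s then LinearMap.proj ⟨j, hj⟩ else 0
  have he : ∀ (s : Finset (Fin m)) (y : Tup m), (∀ j ∉ s, y j = 0) →
      e s (fun j => y j.val) = y := by
    intro s y hy
    funext j
    by_cases hj : j ∈ s
    · simp [e, hj]
    · simp [e, hj, hy j hj]
  let f : ((s → ℝ) × (t → ℝ)) →ₗ[ℝ] (ι → ℝ) :=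
    (M₀.mulVecLin ∘ₗ e s).coprod (M₂.mulVecLin ∘ₗ e t)
  have hf : Function.Surjective f := by
    intro x
    obtain ⟨y, z, hy, hz, hx⟩ := h x
    refine ⟨(fun j => y j.val, fun j => z j.val), ?_⟩
    simp [f, he s y hy, he t z hz, hx]
  have := LinearMap.finrank_le_finrank_of_surjective hf
  simpa using this

theorem card_filter_fin_lt {n : ℕ} (h : n ≤ m) :
    (Finset.univ.filter fun i : Fin m => i.val < n).card = n := by
  rw [Fin.card_filter_val_lt]
  omega

theorem exists_perm_mem_iff (s : Finset (Fin m)) :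
    ∃ σ : Equiv.Perm (Fin m), ∀ i, σ i ∈ s ↔ i.val < s.card := by
  have hle : s.card ≤ m := by simpa using s.card_le_univ
  have e : {i : Fin m // i.val < s.card} ≃ {i : Fin m // i ∈ s} := by
    refine Fintype.equivOfCardEq ?_
    rw [Fintype.card_coe, Fintype.card_subtype, card_filter_fin_lt hle]
  refine ⟨e.extendSubtype, fun i => ⟨fun h => ?_, fun h => e.extendSubtype_mem i h⟩⟩
  by_contra hi
  exact e.extendSubtype_not_mem i hi h

/-- Write `l_a` for the number of `j` with `a ≤ κ j`. The sum of `κ` is `l₁ + l₂ + l₃ + l₄ = 2 card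
ι`, while surjectivity gives `l₁ + l₃ ≥ card ι` and `l₂ + l₄ ≥ card ι`. Both are equalities; since
`l₂ ≤ l₁` and `l₄ ≤ l₃`, it follows that `l₁ = l₂` and `l₃ = l₄`, so no entry is odd. -/
theorem forms_of_stateMap_bijective [Fintype ι] {M₀ M₂ : Matrix ι (Fin m) ℝ} {κ : Fin m → ℕ}
    {b : ι → ℝ} {c : Fin m → ℝ} (hM₂ : M₂ = Matrix.vecMulVec b c)
    (h : Function.Bijective (stateMap M₀ M₂ κ)) :
    (∃ σ : Equiv.Perm (Fin m), κ ∘ σ = kappaOne m (Fintype.card ι)) ∨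
      ∃ (σ : Equiv.Perm (Fin m)) (j : Fin m),
        j.val < Fintype.card ι - 1 ∧ κ ∘ σ = kappaTwo m (Fintype.card ι - 1) j := by
  classical
  have hinj : ∀ x, stateMap M₀ M₂ κ x = 0 → x = 0 := fun x hx => h.1 (by rw [hx, map_zero])
  have h4 : ∀ j, κ j ≤ 4 := by
    intro j
    by_contra! hlt
    have h0 := hinj (fun p => if p.2.val = 4 ∧ p.1 = j then 1 else 0) (by
      rw [stateMap_apply]
      have : ∀ i < 4, extend κ i (fun p => if p.2.val = 4 ∧ p.1 = j then (1 : ℝ) else 0) = 0 := by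
        intro i hi
        have := extend_of_seq (κ := κ) (i := i) (fun i j' => if i = 4 ∧ j' = j then (1 : ℝ) else 0)
          (by intro j' _; simp [hi.ne])
        rw [this]
        funext j'
        simp [hi.ne]
      simp [this])
    have := congrFun h0 ⟨j, ⟨4, hlt⟩⟩
    simp at this
  obtain ⟨hs1, hs2⟩ := stateMap_surjective_iff.1 h.2
  have hc1 := hs1.card_le
  have hc2 := hs2.card_le
  have hsum : ∑ j, κ j = Fintype.card ι + Fintype.card ι := by
    have := (LinearEquiv.ofBijective _ h).finrank_eq
    simpa using this
  have hlev : ∑ j, κ j =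
      (level κ 1).card + (level κ 2).card + (level κ 3).card + (level κ 4).card := by
    simp only [level, Finset.card_filter, ← Finset.sum_add_distrib]
    refine Finset.sum_congr rfl fun j _ => ?_
    have := h4 j
    interval_cases κ j <;> simp
  have hmono : ∀ a, level κ (a + 1) ⊆ level κ a := fun a j hj => by
    simp only [mem_level] at hj ⊢
    omega
  have hle12 : (level κ 2).card ≤ (level κ 1).card := Finset.card_le_card (hmono 1)
  have hle34 : (level κ 4).card ≤ (level κ 3).card := Finset.card_le_card (hmono 3)
  have h12 : level κ 2 = level κ 1 := Finset.eq_of_subset_of_card_le (hmono 1) (by omega)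
  have h34 : level κ 4 = level κ 3 := Finset.eq_of_subset_of_card_le (hmono 3) (by omega)
  have hcard : (level κ 2).card + (level κ 4).card = Fintype.card ι := by omega
  have hval : ∀ j, κ j = if j ∈ level κ 4 then 4 else if j ∈ level κ 2 then 2 else 0 := by
    intro j
    have e12 : 2 ≤ κ j ↔ 1 ≤ κ j := by rw [← mem_level, h12, mem_level]
    have e34 : 4 ≤ κ j ↔ 3 ≤ κ j := by rw [← mem_level, h34, mem_level]
    have := h4 j
    simp only [mem_level]
    split_ifs <;> omega
  -- Third derivatives enter only through the single functional `c`, so two components with `κ = 4`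
  -- would give a nonzero kernel element.
  have hone : (level κ 4).card ≤ 1 := by
    rw [Finset.card_le_one]
    intro j hj j' hj'
    by_contra hne
    have key : ∀ z : Tup m, (∀ i ∉ level κ 4, z i = 0) → ∑ i, c i * z i = 0 → z = 0 := by
      intro z hz hcz
      let Y : ℕ → Tup m := fun i => if i = 3 then z else 0
      have h0 := hinj (fun p => Y p.2.val p.1) (by
        rw [stateMap_apply, extend_of_seq Y (i := 0) (by simp [Y]),
          extend_of_seq Y (i := 1) (by simp [Y]), extend_of_seq Y (i := 2) (by simp [Y]),
          extend_of_seq Y (i := 3) hz]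
        have : M₂.mulVec z = 0 := by
          funext a
          simp only [hM₂, Matrix.mulVec, dotProduct, Matrix.vecMulVec_apply, mul_assoc,
            ← Finset.mul_sum, hcz, mul_zero, Pi.zero_apply]
        simp [Y, this])
      have h3 := extend_of_seq Y (i := 3) hz
      rw [h0, map_zero] at h3
      exact h3.symm
    by_cases hcj : c j = 0
    · have := congrFun (key (Pi.single j 1) (by
        intro i hi
        rw [Pi.single_eq_of_ne]
        rintro rfl
        exact hi hj) (by simp [Pi.single_apply, hcj])) j
      simp at this
    · have := congrFun (key (Pi.single j (c j') - Pi.single j' (c j)) (by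
        intro i hi
        have h1 : i ≠ j := fun h => hi (h ▸ hj)
        have h2 : i ≠ j' := fun h => hi (h ▸ hj')
        simp [h1, h2]) (by
          simp [mul_sub, Finset.sum_sub_distrib, Pi.single_apply, mul_comm])) j'
      simp [Ne.symm hne, hcj] at this
  obtain ⟨σ, hσ⟩ := exists_perm_mem_iff (level κ 2)
  rcases Nat.le_one_iff_eq_zero_or_eq_one.1 hone with h0 | h1
  · left
    refine ⟨σ, ?_⟩
    rw [h0, add_zero] at hcard
    rw [Finset.card_eq_zero] at h0
    funext i
    simp only [Function.comp_apply, kappaOne]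
    rw [hval, h0, ← hcard]
    simp [hσ]
  · right
    obtain ⟨j, hj⟩ := Finset.card_eq_one.1 h1
    have hj2 : j ∈ level κ 2 := by
      have : j ∈ level κ 4 := by simp [hj]
      simp only [mem_level] at this ⊢
      omega
    refine ⟨σ, σ.symm j, ?_, ?_⟩
    · rw [← hcard, h1, Nat.add_sub_cancel, ← hσ, Equiv.apply_symm_apply]
      exact hj2
    · funext i
      simp only [Function.comp_apply, kappaTwo]
      rw [hval, hj, ← hcard, h1, Nat.add_sub_cancel]
      simp [hσ, Equiv.eq_symm_apply]

theorem firstCols_mulVec {n : ℕ} (σ : Equiv.Perm (Fin m)) (M : Matrix ι (Fin m) ℝ) (y : Tup m)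
    (hy : ∀ i : Fin m, n ≤ i.val → y (σ i) = 0) :
    (firstCols n σ M).mulVec (fun i => y (σ i.val)) = M.mulVec y := by
  funext a
  simp only [firstCols, Matrix.mulVec, dotProduct, Matrix.submatrix_apply, id_eq]
  rw [← Equiv.sum_comp σ (fun j => M a j * y j),
    ← Finset.sum_subtype (Finset.univ.filter fun i : Fin m => i.val < n) (by simp)
      (fun i => M a (σ i) * y (σ i))]
  refine Finset.sum_subset (Finset.subset_univ _) fun i _ hi => ?_
  rw [hy i (by simpa using hi), mul_zero]

theorem exists_eq_comp {n : ℕ} (σ : Equiv.Perm (Fin m)) (y' : {i : Fin m // i.val < n} → ℝ) :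
    ∃ y : Tup m, (∀ i : Fin m, n ≤ i.val → y (σ i) = 0) ∧ y' = fun i => y (σ i.val) := by
  refine ⟨fun j => if h : (σ.symm j).val < n then y' ⟨σ.symm j, h⟩ else 0, fun i hi => ?_, ?_⟩
  · simp [Nat.not_lt.2 hi]
  · funext i
    simp [i.2]

theorem rank_eq_card_iff [Fintype ι] {β : Type} [Fintype β] [DecidableEq β] (M : Matrix ι β ℝ) :
    M.rank = Fintype.card ι ↔ ∀ x, ∃ y, M.mulVec y = x := by
  rw [Matrix.rank]
  constructor
  · intro h
    have : LinearMap.range M.mulVecLin = ⊤ := Submodule.eq_top_of_finrank_eq (by simpa using h)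
    exact fun x => LinearMap.range_eq_top.1 this x
  · intro h
    have : LinearMap.range M.mulVecLin = ⊤ := LinearMap.range_eq_top.2 h
    rw [this, finrank_top]
    simp

theorem stateMap_bijective_iff_of_sum [Fintype ι] {M₀ M₂ : Matrix ι (Fin m) ℝ} {κ : Fin m → ℕ}
    (hκ : ∑ j, κ j = 2 * Fintype.card ι) :
    Function.Bijective (stateMap M₀ M₂ κ) ↔ Function.Surjective (stateMap M₀ M₂ κ) := by
  have := LinearMap.injective_iff_surjective_of_finrank_eq_finrank (f := stateMap M₀ M₂ κ)
    (by simp [hκ, two_mul])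
  exact ⟨fun h => h.2, fun h => ⟨this.2 h, h⟩⟩

theorem sum_kappaOne {n : ℕ} (h : n ≤ m) : ∑ i, kappaOne m n i = 2 * n := by
  simp only [kappaOne, ← Finset.sum_filter, Finset.sum_const, card_filter_fin_lt h]
  simp [mul_comm]

theorem sum_kappaTwo {n : ℕ} (h : n ≤ m) {j : Fin m} (hj : j.val < n) :
    ∑ i, kappaTwo m n j i = 2 * (n + 1) := by
  have : ∀ i, kappaTwo m n j i = kappaOne m n i + if i = j then 2 else 0 := by
    intro i
    simp only [kappaTwo, kappaOne]
    by_cases hi : i = j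
    · simp [hi, hj]
    · simp [hi]
  simp only [this, Finset.sum_add_distrib, sum_kappaOne h]
  simp [mul_add]

theorem sum_comp_perm {κ : Fin m → ℕ} (σ : Equiv.Perm (Fin m)) {f : Fin m → ℕ} (h : κ ∘ σ = f) :
    ∑ j, κ j = ∑ i, f i := by
  rw [← Equiv.sum_comp σ κ, ← h]
  rfl

/-- The levels `1` and `2` coincide, as do `3` and `4`, so both blocks ask for the same span; the
dimension count turns surjectivity into bijectivity. The same argument serves the second form. -/
theorem stateMap_bijective_iff_rank_one [Fintype ι] {M₀ M₂ : Matrix ι (Fin m) ℝ} {κ : Fin m → ℕ} {n : ℕ}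
    (hn : Fintype.card ι = n) (hnm : n ≤ m) (σ : Equiv.Perm (Fin m))
    (hκ : κ ∘ σ = kappaOne m n) :
    Function.Bijective (stateMap M₀ M₂ κ) ↔ (firstCols n σ M₀).rank = n := by
  have hκi : ∀ i, κ (σ i) = if i.val < n then 2 else 0 := fun i => congrFun hκ i
  have hk : ∀ a, 1 ≤ a → a ≤ 2 → ∀ i, σ i ∈ level κ a ↔ i.val < n := by
    intro a h1 h2 i
    rw [mem_level, hκi]
    split_ifs with h <;> simp [h] <;> omega
  have hk' : ∀ a, 3 ≤ a → ∀ j, j ∉ level κ a := by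
    intro a h3 j
    rw [mem_level, ← σ.apply_symm_apply j, hκi]
    split_ifs <;> omega
  have hiff : ∀ a, 1 ≤ a → a ≤ 2 →
      (ColsSpan M₀ M₂ (level κ a) (level κ (a + 2)) ↔ (firstCols n σ M₀).rank = n) := by
    intro a h1 h2
    conv_rhs => rw [← hn]
    subst hn
    rw [rank_eq_card_iff]
    refine forall_congr' fun x => ⟨?_, ?_⟩
    · rintro ⟨y, z, hy, hz, rfl⟩
      have hz0 : z = 0 := funext fun j => hz j (hk' _ (by omega) j)
      refine ⟨fun i => y (σ i.val), ?_⟩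
      rw [firstCols_mulVec σ M₀ y fun i hi => hy _ (by rw [hk a h1 h2]; omega), hz0,
        Matrix.mulVec_zero, add_zero]
    · rintro ⟨y', rfl⟩
      obtain ⟨y, hy, rfl⟩ := exists_eq_comp σ y'
      refine ⟨y, 0, fun j hj => ?_, fun _ _ => rfl, ?_⟩
      · rw [← σ.apply_symm_apply j, hk a h1 h2] at hj
        rw [← σ.apply_symm_apply j]
        exact hy _ (by omega)
      · rw [firstCols_mulVec σ M₀ y hy, Matrix.mulVec_zero, add_zero]
  rw [stateMap_bijective_iff_of_sum (by rw [sum_comp_perm σ hκ, sum_kappaOne hnm, hn]),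
    stateMap_surjective_iff, hiff 1 le_rfl (by norm_num), hiff 2 (by norm_num) le_rfl, and_self]

theorem stateMap_bijective_iff_rank_two [Fintype ι] {M₀ M₂ : Matrix ι (Fin m) ℝ} {κ : Fin m → ℕ} {n : ℕ}
    (hn : Fintype.card ι = n + 1) (hnm : n ≤ m) (σ : Equiv.Perm (Fin m)) {j : Fin m}
    (hj : j.val < n) (hκ : κ ∘ σ = kappaTwo m n j) :
    Function.Bijective (stateMap M₀ M₂ κ) ↔
      (Matrix.fromCols (firstCols n σ M₀) (oneCol (σ j) M₂)).rank = n + 1 := by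
  have hκi : ∀ i, κ (σ i) = if i = j then 4 else if i.val < n then 2 else 0 :=
    fun i => congrFun hκ i
  have hk : ∀ a, 1 ≤ a → a ≤ 2 → ∀ i, σ i ∈ level κ a ↔ i.val < n := by
    intro a h1 h2 i
    rw [mem_level, hκi]
    by_cases hi : i = j
    · subst hi; simp [hj]; omega
    · rw [if_neg hi]
      split_ifs with h <;> simp [h] <;> omega
  have hk' : ∀ a, 3 ≤ a → a ≤ 4 → ∀ i, i ∈ level κ a ↔ i = σ j := by
    intro a h3 h4' i
    rw [← Equiv.symm_apply_eq, mem_level]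
    conv_lhs => rw [← σ.apply_symm_apply i, hκi]
    by_cases hi : σ.symm i = j
    · simp [hi]; omega
    · rw [if_neg hi]
      simp only [hi, iff_false]
      split_ifs <;> omega
  have hcol : ∀ v : Unit → ℝ,
      (oneCol (σ j) M₂).mulVec v = M₂.mulVec (Pi.single (σ j) (v ())) := by
    intro v
    funext a
    simp [oneCol, Matrix.mulVec, dotProduct, Pi.single_apply]
  have hiff : ∀ a, 1 ≤ a → a ≤ 2 → (ColsSpan M₀ M₂ (level κ a) (level κ (a + 2)) ↔
      (Matrix.fromCols (firstCols n σ M₀) (oneCol (σ j) M₂)).rank = n + 1) := by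
    intro a h1 h2
    conv_rhs => rw [← hn]
    rw [rank_eq_card_iff]
    refine forall_congr' fun x => ⟨?_, ?_⟩
    · rintro ⟨y, z, hy, hz, rfl⟩
      have hz0 : z = Pi.single (σ j) (z (σ j)) := by
        funext i
        by_cases hi : i = σ j
        · subst hi; simp
        · rw [Pi.single_eq_of_ne hi, hz i (by rw [hk' _ (by omega) (by omega)]; exact hi)]
      refine ⟨Sum.elim (fun i => y (σ i.val)) fun _ => z (σ j), ?_⟩
      rw [Matrix.fromCols_mulVec, Sum.elim_comp_inl, Sum.elim_comp_inr, hcol, ← hz0,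
        firstCols_mulVec σ M₀ y fun i hi => hy _ (by rw [hk a h1 h2]; omega)]
    · rintro ⟨v, rfl⟩
      obtain ⟨y, hy, hyv⟩ := exists_eq_comp σ (v ∘ Sum.inl)
      refine ⟨y, Pi.single (σ j) (v (Sum.inr ())), fun i hi => ?_, fun i hi => ?_, ?_⟩
      · rw [← σ.apply_symm_apply i, hk a h1 h2] at hi
        rw [← σ.apply_symm_apply i]
        exact hy _ (by omega)
      · rw [hk' _ (by omega) (by omega)] at hi
        exact Pi.single_eq_of_ne hi _
      · rw [Matrix.fromCols_mulVec, hyv, firstCols_mulVec σ M₀ y hy, hcol]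
        rfl
  rw [stateMap_bijective_iff_of_sum (by rw [sum_comp_perm σ hκ, sum_kappaTwo hnm hj, hn]),
    stateMap_surjective_iff, hiff 1 le_rfl (by norm_num), hiff 2 (by norm_num) le_rfl, and_self]

theorem card_stIdx {k : ℕ} (hk : k ≤ m) : Fintype.card (StIdx m k) = m + 1 - k := by
  have h := Fintype.card_subtype_compl (fun i : Fin (m + 1) => i.val < k)
  rw [Fintype.card_subtype (fun i : Fin (m + 1) => i.val < k),
    card_filter_fin_lt (by omega), Fintype.card_fin] at h
  rw [← h]
  exact Fintype.card_congr (Equiv.subtypeEquivRight fun i => by simp)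

end

end LagrangianFlatness

namespace LagrangianFlatness

noncomputable section

/-! ### Necessity: linearizing a given closed loop. -/

variable {m k : ℕ}

theorem _root_.HasDerivAt.prodFst {E F : Type*} [NormedAddCommGroup E] [NormedSpace ℝ E]
    [NormedAddCommGroup F] [NormedSpace ℝ F] {Z : ℝ → E × F} {z : E × F} {t : ℝ}
    (h : HasDerivAt Z z t) : HasDerivAt (fun s => (Z s).1) z.1 t :=
  (ContinuousLinearMap.fst ℝ E F).hasFDerivAt.comp_hasDerivAt t h

theorem _root_.HasDerivAt.prodSnd {E F : Type*} [NormedAddCommGroup E] [NormedSpace ℝ E]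
    [NormedAddCommGroup F] [NormedSpace ℝ F] {Z : ℝ → E × F} {z : E × F} {t : ℝ}
    (h : HasDerivAt Z z t) : HasDerivAt (fun s => (Z s).2) z.2 t :=
  (ContinuousLinearMap.snd ℝ E F).hasFDerivAt.comp_hasDerivAt t h

/-- `assemble` as a continuous linear map. -/
def assembleL (hk : k ≤ m) : ((StIdx m k → ℝ) × Tup m) →L[ℝ] Cfg m :=
  LinearMap.toContinuousLinearMap
    { toFun := fun x => assemble hk x.1 x.2
      map_add' := fun x y => by funext i; simp only [assemble, Pi.add_apply]; split_ifs <;> rfl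
      map_smul' := fun c x => by
        funext i; simp only [assemble, Pi.smul_apply]; split_ifs <;> rfl }

/-- The first `k` entries of one tuple followed by the remaining entries of another. -/
def splice (k : ℕ) (c u : Tup m) : Tup m := fun i => if i.val < k then c i else u i

/-- `splice` as a continuous linear map. -/
def spliceL (m k : ℕ) : (Tup m × Tup m) →L[ℝ] Tup m :=
  LinearMap.toContinuousLinearMap
    { toFun := fun x => splice k x.1 x.2
      map_add' := fun x y => by funext i; simp only [splice, Pi.add_apply]; split_ifs <;> rfl
      map_smul' := fun c x => by
        funext i; simp only [splice, Pi.smul_apply]; split_ifs <;> rfl }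

/-- `mixed` as a continuous linear map. -/
def mixedL (m k : ℕ) : (Cfg m × Tup m) →L[ℝ] Tup m :=
  LinearMap.toContinuousLinearMap
    { toFun := fun x => mixed k x.1 x.2
      map_add' := fun x y => by funext i; simp only [mixed, Pi.add_apply]; split_ifs <;> rfl
      map_smul' := fun c x => by
        funext i; simp only [mixed, Pi.smul_apply]; split_ifs <;> rfl }

/-- `statePart` as a continuous linear map. -/
def statePartL (m k : ℕ) : Cfg m →L[ℝ] (StIdx m k → ℝ) :=
  ContinuousLinearMap.pi fun i => ContinuousLinearMap.proj i.val

theorem assembleL_apply (hk : k ≤ m) (s : StIdx m k → ℝ) (c : Tup m) :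
    assembleL hk (s, c) = assemble hk s c := rfl

theorem spliceL_apply (c u : Tup m) : spliceL m k (c, u) = splice k c u := rfl

theorem mixedL_apply (c : Cfg m) (u : Tup m) : mixedL m k (c, u) = mixed k c u := rfl

theorem statePartL_apply (c : Cfg m) : statePartL m k c = statePart k c := rfl

theorem statePart_assemble (hk : k ≤ m) (s : StIdx m k → ℝ) (c : Tup m) :
    statePart k (assemble hk s c) = s := by
  funext i
  simp [statePart, assemble, i.2]

theorem assemble_statePart (hk : k ≤ m) (q : Cfg m) (u : Tup m) :
    assemble hk (statePart k q) (mixed k q u) = q := by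
  funext i
  simp only [assemble, statePart, mixed]
  split_ifs with h1
  · rfl
  · rfl
  · omega

theorem mixed_assemble (hk : k ≤ m) (s : StIdx m k → ℝ) (c u : Tup m) :
    mixed k (assemble hk s c) u = splice k c u := by
  funext i
  simp only [assemble, splice, mixed]
  split_ifs with h1 h2
  · exact absurd h2 (by simpa using h1)
  · rfl
  · rfl

theorem splice_mixed (c : Cfg m) (c' : Cfg m) (u u' : Tup m) :
    splice k (mixed k c u) (mixed k c' u') = mixed k c u' := by
  funext i
  simp only [splice, mixed]
  split_ifs <;> rfl

theorem splice_zero_mixed (c : Cfg m) (u : Tup m) :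
    splice k 0 (mixed k c u) = mixed k 0 u := by
  funext i
  simp only [splice, mixed]
  split_ifs <;> rfl

theorem splice_splice (a b c : Tup m) : splice k a (splice k b c) = splice k a c := by
  funext i
  simp only [splice]
  split_ifs <;> rfl

namespace LCSystem

variable {S : LCSystem m} {qs : Cfg m} {us : Tup m} {N : ℕ}

theorem GenRep.rest (hs : S.IsEquilibrium qs us) (R : S.GenRep k qs us) :
    (∀ i : Fin m, i.val < k → us i = R.force (qs, 0, mixed k 0 us) i) ∧
      R.acc (qs, 0, mixed k 0 us) = 0 := by
  have h := (R.solves qs 0 0 us R.mem_D).1 hs.2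
  exact ⟨h.1, h.2.symm⟩

/-- The arguments of `force` and `acc` in the closed loop. -/
def clArg (hk : k ≤ m) (α : Fin 3 → FbArg m k N → Tup m) (z : FbArg m k N) :
    Cfg m × Cfg m × Tup m :=
  (assembleL hk (z.1, α 0 z), assembleL hk (z.2.1, α 1 z), spliceL m k (α 2 z, α 0 z))

/-- The vector field of the closed loop, together with the differentiation of the inputs. -/
def clField (R : S.GenRep k qs us) (hk : k ≤ m) (α : Fin 3 → FbArg m k N → Tup m)
    (z : FbArg m k N) : FbArg m k N :=
  (z.2.1, R.acc (clArg hk α z), jetShift N m z.2.2)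

/-- The original inputs in the closed loop. -/
def clInput (R : S.GenRep k qs us) (hk : k ≤ m) (α : Fin 3 → FbArg m k N → Tup m)
    (z : FbArg m k N) : Tup m :=
  spliceL m k (R.force (clArg hk α z), α 0 z)

theorem contDiffOn_clArg (hk : k ≤ m) {α : Fin 3 → FbArg m k N → Tup m} {A : Set (FbArg m k N)}
    (hα : ∀ i, ContDiffOn ℝ ∞ (α i) A) : ContDiffOn ℝ ∞ (clArg hk α) A := by
  have h1 : ContDiffOn ℝ ∞ (fun z : FbArg m k N => z.1) A := contDiff_fst.contDiffOn
  have h2 : ContDiffOn ℝ ∞ (fun z : FbArg m k N => z.2.1) A :=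
    (contDiff_fst.comp contDiff_snd).contDiffOn
  exact ((assembleL hk).contDiff.comp_contDiffOn (h1.prodMk (hα 0))).prodMk
    (((assembleL hk).contDiff.comp_contDiffOn (h2.prodMk (hα 1))).prodMk
      ((spliceL m k).contDiff.comp_contDiffOn ((hα 2).prodMk (hα 0))))

theorem contDiffOn_clField (R : S.GenRep k qs us) (hk : k ≤ m)
    {α : Fin 3 → FbArg m k N → Tup m} {A : Set (FbArg m k N)}
    (hα : ∀ i, ContDiffOn ℝ ∞ (α i) A) (hD : ∀ z ∈ A, clArg hk α z ∈ R.D) :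
    ContDiffOn ℝ ∞ (clField R hk α) A := by
  have h2 : ContDiffOn ℝ ∞ (fun z : FbArg m k N => z.2.1) A :=
    (contDiff_fst.comp contDiff_snd).contDiffOn
  have h3 : ContDiffOn ℝ ∞ (fun z : FbArg m k N => z.2.2) A :=
    (contDiff_snd.comp contDiff_snd).contDiffOn
  exact h2.prodMk ((R.acc_smooth.comp (contDiffOn_clArg hk hα) hD).prodMk
    ((jetShift N m).contDiff.comp_contDiffOn h3))

theorem contDiffOn_clInput (R : S.GenRep k qs us) (hk : k ≤ m)
    {α : Fin 3 → FbArg m k N → Tup m} {A : Set (FbArg m k N)}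
    (hα : ∀ i, ContDiffOn ℝ ∞ (α i) A) (hD : ∀ z ∈ A, clArg hk α z ∈ R.D) :
    ContDiffOn ℝ ∞ (clInput R hk α) A :=
  (spliceL m k).contDiff.comp_contDiffOn
    ((R.force_smooth.comp (contDiffOn_clArg hk hα) hD).prodMk (hα 0))

/-- This is `GenRep.solves` read from right to left: the first `k` accelerations are taken from `α
2` and the first `k` inputs from `force`. -/
theorem eqOfMotion_closedLoop (R : S.GenRep k qs us) (hk : k ≤ m)
    (α : Fin 3 → FbArg m k N → Tup m) {z : FbArg m k N} (hz : clArg hk α z ∈ R.D) :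
    S.EqOfMotion (clArg hk α z).1 (clArg hk α z).2.1
      (assembleL hk (R.acc (clArg hk α z), α 2 z)) (clInput R hk α z) := by
  have hm : mixed k (assembleL hk (R.acc (clArg hk α z), α 2 z)) (clInput R hk α z) =
      (clArg hk α z).2.2 := by
    rw [assembleL_apply, mixed_assemble, clInput, spliceL_apply, splice_splice]
    rfl
  refine (R.solves _ _ _ _ (by rw [hm]; exact hz)).2 ⟨fun i hi => ?_, ?_⟩
  · rw [hm]
    exact if_pos hi
  · rw [hm]
    exact statePart_assemble hk _ _

theorem fbArg_eq_of_isSol (R : S.GenRep k qs us) (hk : k ≤ m)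
    {α : Fin 3 → FbArg m k N → Tup m} {O : Set (FbArg m k N)} {I : Set ℝ} (hI : IsOpen I)
    {Z : ℝ → FbArg m k N} (hZ : IsSol (clField R hk α) O I Z) {t : ℝ} (ht : t ∈ I) :
    fbArg N (fun s => (Z s).1) (fun s => (Z s).2.2 0) t = Z t := by
  have h1 : ∀ t ∈ I, HasDerivAt (fun s => (Z s).1) (Z t).2.1 t := fun t ht => (hZ t ht).2.prodFst
  have h3 : ∀ t ∈ I, HasDerivAt (fun s => (Z s).2.2) (jetShift N m (Z t).2.2) t :=
    fun t ht => (hZ t ht).2.prodSnd.prodSnd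
  refine Prod.ext rfl (Prod.ext (h1 t ht).deriv ?_)
  exact (jet_jet_curve hI h3 ht).trans (jetTrunc_self _)

/-- The truncated shift keeps the top derivative of `w` constant, so only locally polynomial inputs
arise. They suffice, since such solutions pass through every point of `O`. -/
theorem isClosedLoop_of_isSol (R : S.GenRep k qs us) (hk : k ≤ m)
    {α : Fin 3 → FbArg m k N → Tup m} {A O : Set (FbArg m k N)} (hOA : O ⊆ A)
    (hf : ContDiffOn ℝ ∞ (clField R hk α) O) {I : Set ℝ} (hI : IsOpen I)
    {Z : ℝ → FbArg m k N} (hZ : IsSol (clField R hk α) O I Z) :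
    IsClosedLoop R hk N α A I (fun s => (Z s).1) (fun s => (Z s).2.2 0) := by
  have hsm := hZ.contDiffOn hI hf
  refine ⟨hI, hsm.fst, contDiffOn_pi.1 hsm.snd.snd 0, fun t ht => ?_, fun t ht => ?_⟩
  · rw [fbArg_eq_of_isSol R hk hI hZ ht]
    exact hOA (hZ t ht).1
  · have h1 : (fun s => deriv (fun s => (Z s).1) s) =ᶠ[nhds t] fun s => (Z s).2.1 :=
      Filter.eventuallyEq_of_mem (hI.mem_nhds ht) fun s hs => (hZ s hs).2.prodFst.deriv
    rw [fbArg_eq_of_isSol R hk hI hZ ht, iteratedDeriv_succ, iteratedDeriv_one, h1.deriv_eq,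
      (hZ t ht).2.prodSnd.prodFst.deriv, (hZ t ht).2.prodFst.deriv]
    rfl

/-- Near rest, the identities `y_[κ] = w` and `q = F_q(y, …)` hold with time derivatives replaced by
Lie derivatives along the closed-loop field. Their differentials at the equilibrium are the
hypotheses of `stateMap_bijective_of_linear`. -/
theorem stateMap_bijective_of_linearizableBy (hs : S.IsEquilibrium qs us) (P : S.ConfigFlat qs us)
    (R : S.GenRep k qs us) (hk : k ≤ m) {κ : Fin m → ℕ} (h : LinearizableBy R hk P κ) :
    Function.Bijective (stateMap (P.jac k 0) (P.jac k 2) κ) := by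
  obtain ⟨N, α, A, hA, hzA, hα, hα0, hα1, hα2, hcl⟩ := h
  obtain ⟨l, W, hW, hWs, htraj⟩ := P.of_trajectory
  set zs : FbArg m k N := (statePart k qs, 0, constJet N (inputAtRest κ (P.φ qs))) with hzs
  set f := clField R hk α with hfdef
  -- values at rest
  have harg : clArg hk α zs = (qs, 0, mixed k 0 us) := by
    simp only [clArg, hα0, hα1, hα2, spliceL_apply, splice_zero_mixed]
    rw [assembleL_apply, hzs, assemble_statePart]
    exact Prod.ext rfl (Prod.ext (map_zero (assembleL hk)) rfl)
  obtain ⟨hforce, hacc⟩ := R.rest hs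
  have hf0 : f zs = 0 := by
    rw [hfdef, clField, harg, hacc, hzs]
    simp
  have hu0 : clInput R hk α zs = us := by
    rw [clInput, harg, hα0, spliceL_apply]
    funext i
    simp only [splice, mixed]
    split_ifs with hi
    · exact (hforce i hi).symm
    · rfl
  -- the domain
  let O₁ : Set (FbArg m k N) := A ∩ clArg hk α ⁻¹' (R.D ∩ {x | x.1 ∈ S.Q})
  have hO₁ : IsOpen O₁ := (contDiffOn_clArg hk hα).continuousOn.isOpen_inter_preimage hA
    (R.isOpen_D.inter (S.isOpen_Q.preimage continuous_fst))
  have hz₁ : zs ∈ O₁ := ⟨hzA, by rw [Set.mem_preimage, harg]; exact ⟨R.mem_D, hs.1⟩⟩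
  have hα' : ∀ i, ContDiffOn ℝ ∞ (α i) O₁ := fun i => (hα i).mono Set.inter_subset_left
  have hf₁ : ContDiffOn ℝ ∞ f O₁ := contDiffOn_clField R hk hα' fun z hz => hz.2.1
  have hu₁ : ContDiffOn ℝ ∞ (clInput R hk α) O₁ :=
    contDiffOn_clInput R hk hα' fun z hz => hz.2.1
  have harg₁ : ContDiffOn ℝ ∞ (clArg hk α) O₁ := contDiffOn_clArg hk hα'
  -- Restricting to the preimage of `W` makes `of_trajectory` applicable to all solutions in `O`.
  let w : FbArg m k N → Cfg m × Cfg m × Jet l m := fun z =>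
    ((clArg hk α z).1, (clArg hk α z).2.1, fun i => (lieD f)^[i.val] (clInput R hk α) z)
  have hw₁ : ContDiffOn ℝ ∞ w O₁ := harg₁.fst.prodMk (harg₁.snd.fst.prodMk
    (contDiffOn_pi.2 fun i => contDiffOn_lieD_iterate hO₁ hf₁ hu₁ i.val))
  let O : Set (FbArg m k N) := O₁ ∩ w ⁻¹' W
  have hO : IsOpen O := hw₁.continuousOn.isOpen_inter_preimage hO₁ hW
  have hz : zs ∈ O := by
    refine ⟨hz₁, ?_⟩
    have : w zs = (qs, 0, constJet l us) := by
      simp only [w, harg]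
      refine Prod.ext rfl (Prod.ext rfl (funext fun i => ?_))
      simp only [constJet]
      split_ifs with hi
      · rw [hi]; exact hu0
      · exact lieD_iterate_eq_zero hf0 hi
    rw [Set.mem_preimage, this]
    exact hWs
  have hOO₁ : O ⊆ O₁ := Set.inter_subset_left
  have hf : ContDiffOn ℝ ∞ f O := hf₁.mono hOO₁
  have hu := hu₁.mono hOO₁
  have harg := harg₁.mono hOO₁
  let y : FbArg m k N → Tup m := fun z => P.φ (clArg hk α z).1
  have hy : ContDiffOn ℝ ∞ y O := P.φ_smooth.comp harg.fst fun z hz => hz.1.2.2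
  -- what the closed loop gives at each point near the equilibrium
  have key : ∀ z ∈ O, (∀ j, (lieD f)^[κ j] y z j = z.2.2 0 j) ∧
      (clArg hk α z).1 = P.Fq fun i => (lieD f)^[i.val] y z := by
    intro z hzO
    obtain ⟨I, Z, hI, h0, rfl, hZ⟩ := exists_isSol hO hf hzO
    have hc := hcl I _ _ (isClosedLoop_of_isSol R hk (fun z hz => hz.1.1) hf hI hZ)
    have hfb : ∀ t ∈ I, fbArg N (fun s => (Z s).1) (fun s => (Z s).2.2 0) t = Z t :=
      fun t ht => fbArg_eq_of_isSol R hk hI hZ ht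
    have hev : ∀ t ∈ I, ∀ᶠ s in nhds t,
        fbArg N (fun s => (Z s).1) (fun s => (Z s).2.2 0) s = Z s := fun t ht =>
      Filter.mem_of_superset (hI.mem_nhds ht) hfb
    have ha0 : ∀ t ∈ I, HasDerivAt (fun s => α 0 (Z s)) (α 1 (Z t)) t := fun t ht => by
      have := (hc t ht).1
      rw [hfb t ht] at this
      exact this.congr_of_eventuallyEq ((hev t ht).mono fun s hs => by simp only [hs])
    have ha1 : ∀ t ∈ I, HasDerivAt (fun s => α 1 (Z s)) (α 2 (Z t)) t := fun t ht => by
      have := (hc t ht).2.1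
      rw [hfb t ht] at this
      exact this.congr_of_eventuallyEq ((hev t ht).mono fun s hs => by simp only [hs])
    have hq1 : ∀ t ∈ I, HasDerivAt (fun s => (clArg hk α (Z s)).1) (clArg hk α (Z t)).2.1 t :=
      fun t ht => (assembleL hk).hasFDerivAt.comp_hasDerivAt t
        ((hZ t ht).2.prodFst.prodMk (ha0 t ht))
    have hq2 : ∀ t ∈ I, HasDerivAt (fun s => (clArg hk α (Z s)).2.1)
        (assembleL hk (R.acc (clArg hk α (Z t)), α 2 (Z t))) t :=
      fun t ht => (assembleL hk).hasFDerivAt.comp_hasDerivAt t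
        ((hZ t ht).2.prodSnd.prodFst.prodMk (ha1 t ht))
    have hq2' : ∀ t ∈ I, iteratedDeriv 2 (fun s => (clArg hk α (Z s)).1) t =
        assembleL hk (R.acc (clArg hk α (Z t)), α 2 (Z t)) := by
      intro t ht
      have h1 : deriv (fun s => (clArg hk α (Z s)).1) =ᶠ[nhds t]
          fun s => (clArg hk α (Z s)).2.1 :=
        Filter.eventuallyEq_of_mem (hI.mem_nhds ht) fun s hs => (hq1 s hs).deriv
      rw [iteratedDeriv_succ, iteratedDeriv_one, h1.deriv_eq, (hq2 t ht).deriv]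
    have hsm := hZ.contDiffOn hI hf
    have hmaps : Set.MapsTo Z I O := fun t ht => (hZ t ht).1
    have htr : S.IsTrajectory I (fun s => (clArg hk α (Z s)).1) fun s => clInput R hk α (Z s) := by
      refine ⟨hI, harg.fst.comp hsm hmaps, hu.comp hsm hmaps, fun t ht => (hZ t ht).1.1.2.2,
        fun t ht => ?_⟩
      rw [(hq1 t ht).deriv, hq2' t ht]
      exact eqOfMotion_closedLoop R hk α (hZ t ht).1.1.2.1
    have hjet : jet P.r (fun s => P.φ (clArg hk α (Z s)).1) 0 =
        fun i => (lieD f)^[i.val] y (Z 0) := funext fun i =>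
      hZ.iteratedDeriv_comp hO hI hf hy i.val h0
    have hlast := htraj I _ _ htr (fun t ht => by
      rw [(hq1 t ht).deriv]
      have : jet l (fun s => clInput R hk α (Z s)) t =
          fun i => (lieD f)^[i.val] (clInput R hk α) (Z t) := funext fun i =>
        hZ.iteratedDeriv_comp hO hI hf hu i.val ht
      rw [this]
      exact (hZ t ht).1.2) 0 h0
    rw [hjet] at hlast
    refine ⟨fun j => ?_, hlast.2.1⟩
    have hj := (hc 0 h0).2.2 j
    have hev' : (fun s => P.φ (assemble hk ((fun s => (Z s).1) s)
        (α 0 (fbArg N (fun s => (Z s).1) (fun s => (Z s).2.2 0) s))) j) =ᶠ[nhds 0]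
        fun s => y (Z s) j := (hev 0 h0).mono fun s hs => by simp only [hs]; rfl
    rw [hev'.iteratedDeriv_eq, hZ.iteratedDeriv_comp (h := fun z => y z j) hO hI hf
      (contDiffOn_pi.1 hy j) (κ j) h0] at hj
    rw [← hj]
    exact (lieD_iterate_clm_comp (ContinuousLinearMap.proj (R := ℝ) (φ := fun _ : Fin m => ℝ) j)
      hO hf hy (κ j) (hZ 0 h0).1).symm
  -- linearization
  have hy0 : (fun i : Fin (P.r + 1) => (lieD f)^[i.val] y zs) = constJet P.r (P.φ qs) := by
    funext i
    simp only [constJet]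
    split_ifs with hi
    · rw [hi]
      simp only [Function.iterate_zero, id_eq, y]
      congr 1
      simpa [w] using congrArg Prod.fst ‹clArg hk α zs = (qs, 0, mixed k 0 us)›
    · exact lieD_iterate_eq_zero hf0 hi
  have hDi := fun i => (contDiffOn_lieD_iterate hO hf hy i).hasFDerivAt_of_isOpen hO hz
  have hDe := fun i e => fderiv_lieD_iterate hO hf hy hz hf0 i e
  have hDf := hf.hasFDerivAt_of_isOpen hO hz
  refine stateMap_bijective_of_linear (N := N) (fderiv ℝ f zs).toLinearMap
    (fderiv ℝ y zs).toLinearMap (fun e => ?_) (fun e => ?_) (fun e j => ?_) (fun e => ?_)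
  · have h1 := hDf.fst
    have h2 : HasFDerivAt (fun z : FbArg m k N => z.2.1) _ zs := (hasFDerivAt_snd (𝕜 := ℝ)).fst
    exact DFunLike.congr_fun (h1.unique h2) e
  · have h1 := hDf.snd.snd
    have h2 : HasFDerivAt (fun z : FbArg m k N => jetShift N m z.2.2) _ zs :=
      (jetShift N m).hasFDerivAt.comp zs (hasFDerivAt_snd (𝕜 := ℝ)).snd
    exact DFunLike.congr_fun (h1.unique h2) e
  · have h1 := hasFDerivAt_pi'.1 (hDi (κ j)) j
    have h2 := (ContinuousLinearMap.proj (R := ℝ) (φ := fun _ : Fin m => ℝ) j ∘L jetCoord N m 0 ∘L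
      ContinuousLinearMap.snd ℝ (StIdx m k → ℝ) (Jet N m) ∘L
      ContinuousLinearMap.snd ℝ (StIdx m k → ℝ) _).hasFDerivAt (x := zs)
    have h3 := DFunLike.congr_fun ((h1.congr_of_eventuallyEq
      (Filter.eventuallyEq_of_mem (hO.mem_nhds hz) fun z hz => by
        refine Eq.trans ?_ ((key z hz).1 j).symm
        simp only [ContinuousLinearMap.comp_apply]
        rw [jetCoord_of_lt _ (by omega)]
        rfl)).unique h2) e
    exact (congrFun (hDe (κ j) e).symm j).trans h3
  · have hF : HasFDerivAt P.Fq (fderiv ℝ P.Fq (constJet P.r (P.φ qs)))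
        (fun i : Fin (P.r + 1) => (lieD f)^[i.val] y zs) := by
      rw [hy0]
      exact P.Fq_smooth.hasFDerivAt_of_isOpen P.isOpen_U P.mem_U
    have h1 := (statePartL m k).hasFDerivAt.comp zs (hF.comp zs
      (hasFDerivAt_pi.2 fun i : Fin (P.r + 1) => hDi i.val))
    have h2 : HasFDerivAt (fun z : FbArg m k N => z.1) _ zs := hasFDerivAt_fst (𝕜 := ℝ)
    have h3 := DFunLike.congr_fun ((h1.congr_of_eventuallyEq
      (Filter.eventuallyEq_of_mem (hO.mem_nhds hz) fun z hz => by
        simp only [Function.comp_apply]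
        rw [← (key z hz).2]
        exact (statePart_assemble hk z.1 (α 0 z)).symm)).unique h2) e
    refine h3.symm.trans ?_
    refine Eq.trans ?_ (P.statePart_fderiv hs k fun i => fderiv ℝ y zs ((fderiv ℝ f zs)^[i] e))
    simp only [← hDe]
    rfl

end LCSystem

end

end LagrangianFlatness

namespace LagrangianFlatness

noncomputable section

/-! ### Sufficiency: constructing the feedback by the inverse function theorem. -/

variable {m k : ℕ}

/-- The jet of an output `y` in terms of its derivatives of order less than `κ` and of the jet
of `y_[κ]`. -/
def embedJet (κ : Fin m → ℕ) (ρ : ℕ) : (((Σ j, Fin (κ j)) → ℝ) × Jet ρ m) →L[ℝ] Jet ρ m :=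
  LinearMap.toContinuousLinearMap
    { toFun := fun x i j =>
        extend κ i.val x.1 j + if κ j ≤ i.val then jetCoord ρ m (i.val - κ j) x.2 j else 0
      map_add' := fun x y => by
        funext i j
        simp only [Prod.fst_add, Prod.snd_add, map_add, Pi.add_apply]
        split_ifs <;> ring
      map_smul' := fun c x => by
        funext i j
        simp only [Prod.smul_fst, Prod.smul_snd, map_smul, Pi.smul_apply, smul_eq_mul,
          RingHom.id_apply]
        split_ifs <;> ring }

theorem jetCoord_embedJet {κ : Fin m → ℕ} {ρ i : ℕ} (hi : i ≤ ρ) (x : (Σ j, Fin (κ j)) → ℝ)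
    (w : Jet ρ m) (j : Fin m) :
    jetCoord ρ m i (embedJet κ ρ (x, w)) j =
      extend κ i x j + if κ j ≤ i then jetCoord ρ m (i - κ j) w j else 0 := by
  rw [jetCoord_of_lt _ (Nat.lt_succ_of_le hi)]
  rfl

theorem jetCoord_embedJet_zero {κ : Fin m → ℕ} {ρ i : ℕ} (hi : i ≤ ρ)
    (x : (Σ j, Fin (κ j)) → ℝ) :
    jetCoord ρ m i (embedJet κ ρ (x, 0)) = extend κ i x := by
  funext j
  rw [jetCoord_embedJet hi]
  simp

theorem embedJet_rest (κ : Fin m → ℕ) (ρ : ℕ) (y : Tup m) :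
    embedJet κ ρ (fun p => if p.2.val = 0 then y p.1 else 0, constJet ρ (inputAtRest κ y)) =
      constJet ρ y := by
  refine jet_ext fun i hi => funext fun j => ?_
  rw [jetCoord_embedJet hi, jetCoord_constJet, jetCoord_constJet]
  rcases Nat.lt_or_ge i (κ j) with h | h
  · rw [extend_of_lt h, if_neg (Nat.not_le.2 h), add_zero]
    by_cases h0 : i = 0 <;> simp [h0]
  · rw [extend_of_le h, if_pos h, zero_add]
    by_cases h0 : i = 0
    · have : κ j = 0 := by omega
      simp [h0, inputAtRest, this]
    · by_cases h1 : i - κ j = 0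
      · have : κ j ≠ 0 := by omega
        simp [h0, h1, inputAtRest, this]
      · simp [h0, h1]

theorem hasDerivAt_iteratedDeriv {V : Type*} [NormedAddCommGroup V] [NormedSpace ℝ V]
    {c : ℝ → V} {I : Set ℝ} (hI : IsOpen I)
    (hc : ContDiffOn ℝ ∞ c I) {t : ℝ} (ht : t ∈ I) (i : ℕ) :
    HasDerivAt (iteratedDeriv i c) (iteratedDeriv (i + 1) c t) t := by
  have hs : ∀ i, ContDiffOn ℝ ∞ (iteratedDeriv i c) I := by
    intro i
    induction i with
    | zero => simpa using hc
    | succ i ih =>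
      rw [iteratedDeriv_succ]
      exact ((contDiffOn_infty_iff_deriv_of_isOpen hI).1 ih).2
  rw [iteratedDeriv_succ]
  exact (((hs i).contDiffAt (hI.mem_nhds ht)).differentiableAt (by simp)).hasDerivAt

namespace LCSystem

variable {S : LCSystem m} {qs : Cfg m} {us : Tup m}

namespace ConfigFlat

variable (P : S.ConfigFlat qs us) (ρ : ℕ)

/-- The parameterization of the generalized input. -/
def inputParam (k : ℕ) (J : Jet ρ m) : Tup m := mixedL m k (P.Fqr ρ J, P.Fur ρ J)

theorem contDiffOn_inputParam : ContDiffOn ℝ ∞ (P.inputParam ρ k) (P.dom ρ) :=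
  (mixedL m k).contDiff.comp_contDiffOn ((P.contDiffOn_Fqr ρ).prodMk (P.contDiffOn_Fur ρ))

theorem hasOrder_inputParam : HasOrder P.r (P.inputParam ρ k) :=
  HasOrder.comp_jetTrunc fun J => mixedL m k (P.Fq J, P.Fu J)

theorem lieD_iterate_inputParam (i : ℕ) {J : Jet ρ m} (hJ : J ∈ P.dom ρ) :
    (lieD (jetShift ρ m))^[i] (P.inputParam ρ k) J =
      mixed k ((lieD (jetShift ρ m))^[i] (P.Fqr ρ) J) ((lieD (jetShift ρ m))^[i] (P.Fur ρ) J) := by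
  have hp := (P.contDiffOn_Fqr ρ).prodMk (P.contDiffOn_Fur ρ)
  have h0 := lieD_iterate_clm_comp (mixedL m k) (P.isOpen_dom ρ) (P.contDiffOn_jetShift ρ) hp i hJ
  have h1 := lieD_iterate_clm_comp (ContinuousLinearMap.fst ℝ (Cfg m) (Tup m)) (P.isOpen_dom ρ)
    (P.contDiffOn_jetShift ρ) hp i hJ
  have h2 := lieD_iterate_clm_comp (ContinuousLinearMap.snd ℝ (Cfg m) (Tup m)) (P.isOpen_dom ρ)
    (P.contDiffOn_jetShift ρ) hp i hJ
  refine h0.trans ?_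
  simp only [ContinuousLinearMap.coe_fst', ContinuousLinearMap.coe_snd'] at h1 h2
  rw [← mixedL_apply]
  exact congrArg (mixedL m k) (Prod.ext h1.symm h2.symm)

/-- The generalized state and the new input, in terms of the derivatives of the output of order
less than `κ` and the jet of the new input. -/
def stateParam (k : ℕ) (κ : Fin m → ℕ) (s : ((Σ j, Fin (κ j)) → ℝ) × Jet ρ m) : FbArg m k ρ :=
  (statePartL m k (P.Fqr ρ (embedJet κ ρ s)),
    statePartL m k (lieD (jetShift ρ m) (P.Fqr ρ) (embedJet κ ρ s)), s.2)

theorem contDiffOn_stateParam (κ : Fin m → ℕ) :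
    ContDiffOn ℝ ∞ (P.stateParam ρ k κ) (embedJet κ ρ ⁻¹' P.dom ρ) := by
  have h : ContDiffOn ℝ ∞ (embedJet κ ρ) (embedJet κ ρ ⁻¹' P.dom ρ) :=
    (embedJet κ ρ).contDiff.contDiffOn
  exact ((statePartL m k).contDiff.comp_contDiffOn ((P.contDiffOn_Fqr ρ).comp h fun _ h => h)).prodMk
    (((statePartL m k).contDiff.comp_contDiffOn ((contDiffOn_lieD (P.isOpen_dom ρ)
      (P.contDiffOn_jetShift ρ) (P.contDiffOn_Fqr ρ)).comp h fun _ h => h)).prodMk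
      contDiff_snd.contDiffOn)

theorem hasFDerivAt_stateParam (κ : Fin m → ℕ) {s : ((Σ j, Fin (κ j)) → ℝ) × Jet ρ m}
    (hs : embedJet κ ρ s ∈ P.dom ρ) :
    ∃ D : (((Σ j, Fin (κ j)) → ℝ) × Jet ρ m) →L[ℝ] FbArg m k ρ,
      HasFDerivAt (P.stateParam ρ k κ) D s ∧ ∀ e, D e =
      (statePart k (fderiv ℝ (P.Fqr ρ) (embedJet κ ρ s) (embedJet κ ρ e)),
        statePart k (fderiv ℝ (lieD (jetShift ρ m) (P.Fqr ρ)) (embedJet κ ρ s)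
          (embedJet κ ρ e)), e.2) := by
  have h0 := ((P.contDiffOn_Fqr ρ).hasFDerivAt_of_isOpen (P.isOpen_dom ρ) hs).comp s
    (embedJet κ ρ).hasFDerivAt
  have h1 := ((contDiffOn_lieD (P.isOpen_dom ρ) (P.contDiffOn_jetShift ρ)
    (P.contDiffOn_Fqr ρ)).hasFDerivAt_of_isOpen (P.isOpen_dom ρ) hs).comp s
    (embedJet κ ρ).hasFDerivAt
  exact ⟨_, ((statePartL m k).hasFDerivAt.comp s h0).prodMk
    (((statePartL m k).hasFDerivAt.comp s h1).prodMk hasFDerivAt_snd), fun e => rfl⟩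

end ConfigFlat

/-- `stateParam` is a local diffeomorphism, since its differential is block triangular with blocks
`stateMap` and the identity. Its inverse followed by the parameterization of `ũ` is the feedback.
The main point is that the jet `J` reconstructed along a closed-loop solution consists of genuine
time derivatives. -/
theorem linearizableBy_of_stateMap_bijective (hs : S.IsEquilibrium qs us) (P : S.ConfigFlat qs us)
    (R : S.GenRep k qs us) (hk : k ≤ m) {κ : Fin m → ℕ}
    (hT : Function.Bijective (stateMap (P.jac k 0) (P.jac k 2) κ)) :
    LinearizableBy R hk P κ := by
  -- Large enough for the orders up to `3` used by `stateMap`, for every `κ j`, and for `P.r + 1 <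
  -- ρ`, the order of a first Lie derivative of the parameterization.
  set ρ := P.r + 4 + ∑ j, κ j with hρ
  have hκρ : ∀ j, κ j ≤ ρ := fun j =>
    (Finset.single_le_sum (fun _ _ => Nat.zero_le _) (Finset.mem_univ j)).trans
      (Nat.le_add_left _ _)
  have hO := P.isOpen_dom ρ
  have hc := P.constJet_mem_dom ρ
  have hsh := P.contDiffOn_jetShift ρ
  have hF := P.contDiffOn_Fqr ρ
  obtain ⟨hq0, hu0⟩ := P.param_constJet hs
  have hs0 : jetShift ρ m (constJet ρ (P.φ qs)) = 0 := jetShift_constJet _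
  have hFi := fun i => contDiffOn_lieD_iterate hO hsh hF i
  let p₀ : ((Σ j, Fin (κ j)) → ℝ) × Jet ρ m :=
    (fun p => if p.2.val = 0 then P.φ qs p.1 else 0, constJet ρ (inputAtRest κ (P.φ qs)))
  have hp₀ : embedJet κ ρ p₀ = constJet ρ (P.φ qs) := embedJet_rest κ ρ (P.φ qs)
  -- good jets
  let gArg : Jet ρ m → Cfg m × Cfg m × Tup m := fun J =>
    (P.Fqr ρ J, lieD (jetShift ρ m) (P.Fqr ρ) J,
      mixedL m k ((lieD (jetShift ρ m))^[2] (P.Fqr ρ) J, P.Fur ρ J))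
  have hgArg : ContDiffOn ℝ ∞ gArg (P.dom ρ) := hF.prodMk ((hFi 1).prodMk
    ((mixedL m k).contDiff.comp_contDiffOn ((hFi 2).prodMk (P.contDiffOn_Fur ρ))))
  let G : Set (Jet ρ m) := P.dom ρ ∩ gArg ⁻¹' R.D
  have hG : IsOpen G := hgArg.continuousOn.isOpen_inter_preimage hO R.isOpen_D
  have hGc : constJet ρ (P.φ qs) ∈ G := by
    refine ⟨hc, ?_⟩
    have : gArg (constJet ρ (P.φ qs)) = (qs, 0, mixed k 0 us) := by
      refine Prod.ext ?_ (Prod.ext ?_ ?_)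
      · simpa [gArg, ConfigFlat.Fqr] using hq0
      · exact lieD_iterate_eq_zero (i := 1) hs0 one_ne_zero
      · simp only [gArg]
        rw [lieD_iterate_eq_zero hs0 two_ne_zero, mixedL_apply]
        simp [ConfigFlat.Fur, hu0]
    rw [Set.mem_preimage, this]
    exact R.mem_D
  have hacc : ∀ J ∈ G, R.acc (gArg J) =
      statePart k ((lieD (jetShift ρ m))^[2] (P.Fqr ρ) J) := fun J hJ =>
    ((R.solves _ _ _ _ hJ.2).1 (P.param_identities ρ hJ.1).2.2).2.symm
  -- the local inverse
  let O₁ := embedJet κ ρ ⁻¹' G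
  have hO₁ : IsOpen O₁ := hG.preimage (embedJet κ ρ).continuous
  have hp₁ : p₀ ∈ O₁ := by
    rw [Set.mem_preimage, hp₀]; exact hGc
  have hΨ : ContDiffOn ℝ ∞ (P.stateParam ρ k κ) O₁ :=
    (P.contDiffOn_stateParam ρ κ).mono fun s hs => hs.1
  have hΨ0 : P.stateParam ρ k κ p₀ =
      (statePart k qs, 0, constJet ρ (inputAtRest κ (P.φ qs))) := by
    simp only [ConfigFlat.stateParam, hp₀]
    refine Prod.ext ?_ (Prod.ext ?_ rfl)
    · simp [ConfigFlat.Fqr, hq0, statePartL_apply]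
    · rw [show lieD (jetShift ρ m) (P.Fqr ρ) (constJet ρ (P.φ qs)) = 0 from
        lieD_iterate_eq_zero (i := 1) hs0 one_ne_zero, map_zero]
  obtain ⟨D, hD, hDe⟩ := P.hasFDerivAt_stateParam (k := k) ρ κ (s := p₀)
    (by rw [hp₀]; exact hc)
  have hDx : ∀ x, D (x, 0) = ((stateMap (P.jac k 0) (P.jac k 2) κ x).1,
      (stateMap (P.jac k 0) (P.jac k 2) κ x).2, 0) := by
    intro x
    have h1 : ∀ i, i ≤ 3 → jetCoord ρ m i (embedJet κ ρ (x, 0)) = extend κ i x := fun i hi =>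
      jetCoord_embedJet_zero (by omega) x
    rw [hDe, hp₀, stateMap_apply, ← h1 0 (by norm_num), ← h1 1 (by norm_num),
      ← h1 2 (by norm_num), ← h1 3 (by norm_num)]
    refine Prod.ext ?_ (Prod.ext ?_ rfl)
    · simp only [P.fderiv_Fqr]
      exact P.statePart_fderiv hs k fun i => jetCoord ρ m i (embedJet κ ρ (x, 0))
    · have := fderiv_lieD_iterate hO hsh hF hc hs0 1 (embedJet κ ρ (x, 0))
      rw [(jetShift ρ m).fderiv, P.fderiv_Fqr] at this
      refine (congrArg (statePart k) this).trans ?_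
      refine Eq.trans ?_
        (P.statePart_fderiv hs k fun i => jetCoord ρ m (i + 1) (embedJet κ ρ (x, 0)))
      congr 2
      funext i
      exact jetCoord_jetShift i.val _
  have hDadd : ∀ x w, D (x, w) = D (x, 0) + D (0, w) := fun x w => by
    rw [← map_add]; simp
  have hDbij : Function.Bijective D := by
    constructor
    · refine (injective_iff_map_eq_zero D).2 ?_
      rintro ⟨x, w⟩ h0
      obtain rfl : w = 0 := by
        have := hDe (x, w)
        rw [h0] at this
        exact (congrArg (fun z => z.2.2) this).symm
      rw [hDx] at h0
      have hx : stateMap (P.jac k 0) (P.jac k 2) κ x = 0 :=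
        Prod.ext (congrArg (fun z => z.1) h0) (congrArg (fun z => z.2.1) h0)
      rw [hT.1 (hx.trans (map_zero _).symm)]
      rfl
    · rintro ⟨a, b, w⟩
      obtain ⟨x, hx⟩ := hT.2 (a - (D (0, w)).1, b - (D (0, w)).2.1)
      refine ⟨(x, w), ?_⟩
      have hw : (D (0, w)).2.2 = w := by rw [hDe]
      rw [hDadd, hDx, hx]
      refine Prod.ext ?_ (Prod.ext ?_ ?_)
      · simp
      · simp
      · simp [hw]
  let D' : (((Σ j, Fin (κ j)) → ℝ) × Jet ρ m) ≃L[ℝ] FbArg m k ρ :=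
    (LinearEquiv.ofBijective D.toLinearMap hDbij).toContinuousLinearEquiv
  have hD' : HasFDerivAt (P.stateParam ρ k κ) (D' : _ →L[ℝ] FbArg m k ρ) p₀ := hD
  have hΨp : ContDiffAt ℝ ∞ (P.stateParam ρ k κ) p₀ := hΨ.contDiffAt (hO₁.mem_nhds hp₁)
  let e := hΨp.toOpenPartialHomeomorph (P.stateParam ρ k κ) hD' (by simp)
  have he : ∀ p, e p = P.stateParam ρ k κ p := fun p => rfl
  have hpe : p₀ ∈ e.source := hΨp.mem_toOpenPartialHomeomorph_source hD' (by simp)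
  -- Invertibility of the differential on a whole neighbourhood gives smoothness of `e.symm` there,
  -- and later the injectivity of `L` along solutions.
  let O₂ := O₁ ∩ fderiv ℝ (P.stateParam ρ k κ) ⁻¹' Set.range
    ((↑) : ((((Σ j, Fin (κ j)) → ℝ) × Jet ρ m) ≃L[ℝ] FbArg m k ρ) → _ →L[ℝ] FbArg m k ρ)
  have hO₂ : IsOpen O₂ :=
    (hΨ.fderiv_of_isOpen hO₁ (m := ∞) (by simp)).continuousOn.isOpen_inter_preimage hO₁
      ContinuousLinearEquiv.isOpen
  have hp₂ : p₀ ∈ O₂ := ⟨hp₁, D', hD'.fderiv.symm⟩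
  let A := e.target ∩ e.symm ⁻¹' O₂
  have hA : IsOpen A := e.isOpen_inter_preimage_symm hO₂
  have hesymm : ContDiffOn ℝ ∞ e.symm A := by
    rintro z ⟨hz, hz₁, L, hL⟩
    refine (e.contDiffAt_symm hz (f₀' := L) ?_ (hΨ.contDiffAt (hO₁.mem_nhds hz₁))).contDiffWithinAt
    rw [hL]
    exact hΨ.hasFDerivAt_of_isOpen hO₁ hz₁
  -- The derivatives of the feedback are defined formally, by the shift; that they are true time
  -- derivatives along the loop is shown by `hcomp`.
  let α : Fin 3 → FbArg m k ρ → Tup m := fun i z =>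
    (lieD (jetShift ρ m))^[i.val] (P.inputParam ρ k) (embedJet κ ρ (e.symm z))
  have hez : e.symm (statePart k qs, 0, constJet ρ (inputAtRest κ (P.φ qs))) = p₀ := by
    rw [← hΨ0, ← he, e.left_inv hpe]
  have hαz : ∀ i : Fin 3, i.val ≠ 0 →
      α i (statePart k qs, 0, constJet ρ (inputAtRest κ (P.φ qs))) = 0 := by
    intro i hi
    simp only [α, hez, hp₀]
    exact lieD_iterate_eq_zero hs0 hi
  have hαG : ∀ z ∈ A, embedJet κ ρ (e.symm z) ∈ G := fun z hz => hz.2.1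
  refine ⟨ρ, α, A, hA, ?_, fun i => ?_, ?_, hαz 1 (by simp), hαz 2 (by simp), ?_⟩
  · refine ⟨?_, ?_⟩
    · rw [← hΨ0]
      exact e.map_source hpe
    · rw [Set.mem_preimage, hez]
      exact hp₂
  · exact (contDiffOn_lieD_iterate hO hsh (P.contDiffOn_inputParam ρ) i.val).comp
      ((embedJet κ ρ).contDiff.comp_contDiffOn hesymm) fun z hz => (hαG z hz).1
  · simp only [α, hez, hp₀]
    change mixed k (P.Fqr ρ _) (P.Fur ρ _) = _
    simp [ConfigFlat.Fqr, ConfigFlat.Fur, hq0, hu0]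
  -- along the closed loop
  intro I qt w hcl
  have hI := hcl.isOpen
  set Z : ℝ → FbArg m k ρ := fbArg ρ qt w with hZdef
  let J : ℝ → Jet ρ m := fun t => embedJet κ ρ (e.symm (Z t))
  have hJG : ∀ t ∈ I, J t ∈ G := fun t ht => hαG _ (hcl.mem t ht)
  have hΨZ : ∀ t ∈ I, P.stateParam ρ k κ (e.symm (Z t)) = Z t := fun t ht => by
    rw [← he, e.right_inv (hcl.mem t ht).1]
  have hJq : ∀ t ∈ I, statePart k (P.Fqr ρ (J t)) = qt t := fun t ht =>
    congrArg (fun z => z.1) (hΨZ t ht)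
  have hJv : ∀ t ∈ I, statePart k (lieD (jetShift ρ m) (P.Fqr ρ) (J t)) = deriv qt t :=
    fun t ht => congrArg (fun z => z.2.1) (hΨZ t ht)
  have hJw : ∀ t ∈ I, (e.symm (Z t)).2 = jet ρ w t := fun t ht =>
    congrArg (fun z => z.2.2) (hΨZ t ht)
  have hJcoord : ∀ t ∈ I, ∀ i ≤ ρ, ∀ j, κ j ≤ i →
      jetCoord ρ m i (J t) j = iteratedDeriv (i - κ j) w t j := by
    intro t ht i hi j hj
    simp only [J]
    rw [← Prod.mk.eta (p := e.symm (Z t)), jetCoord_embedJet hi, extend_of_le hj, if_pos hj,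
      zero_add, hJw t ht, jetCoord_jet (by omega)]
  -- With these `α`, the arguments of `acc` are those given by the parameterization at `J t`, which
  -- satisfies the equations of motion identically.
  have hmotion : ∀ t ∈ I, iteratedDeriv 2 qt t =
      statePart k ((lieD (jetShift ρ m))^[2] (P.Fqr ρ) (J t)) := by
    intro t ht
    have hα : ∀ i : Fin 3, α i (Z t) = mixed k ((lieD (jetShift ρ m))^[i.val] (P.Fqr ρ) (J t))
        ((lieD (jetShift ρ m))^[i.val] (P.Fur ρ) (J t)) := fun i =>
      P.lieD_iterate_inputParam ρ i.val (hJG t ht).1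
    rw [hcl.motion t ht, ← hacc _ (hJG t ht)]
    change R.acc (assemble hk (qt t) (α 0 (Z t)), assemble hk (deriv qt t) (α 1 (Z t)),
      splice k (α 2 (Z t)) (α 0 (Z t))) = _
    rw [hα, hα, hα, splice_mixed, ← hJq t ht, ← hJv t ht]
    congr 1
    exact Prod.ext (assemble_statePart hk _ _) (Prod.ext (assemble_statePart hk _ _) rfl)
  have hJder : ∀ t ∈ I, ∃ J', HasDerivAt J J' t ∧
      ∀ i < ρ, jetCoord ρ m i J' = jetCoord ρ m (i + 1) (J t) := by
    intro t ht
    have hZd : HasDerivAt Z (deriv qt t, iteratedDeriv 2 qt t,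
        fun i => iteratedDeriv (i.val + 1) w t) t := by
      have hq : ∀ i, HasDerivAt (iteratedDeriv i qt) (iteratedDeriv (i + 1) qt t) t :=
        hasDerivAt_iteratedDeriv hI hcl.smooth_q ht
      have h0 := hq 0
      have h1 := hq 1
      rw [zero_add, iteratedDeriv_zero, iteratedDeriv_one] at h0
      rw [iteratedDeriv_one] at h1
      exact h0.prodMk (h1.prodMk (hasDerivAt_pi.2 fun i =>
        hasDerivAt_iteratedDeriv hI hcl.smooth_w ht i.val))
    have hsd := (hesymm.hasFDerivAt_of_isOpen hA (hcl.mem t ht)).comp_hasDerivAt t hZd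
    generalize fderiv ℝ e.symm (fbArg ρ qt w t) (deriv qt t, iteratedDeriv 2 qt t,
        fun i => iteratedDeriv (i.val + 1) w t) = s' at hsd
    have hJd : HasDerivAt J (embedJet κ ρ s') t :=
      (embedJet κ ρ).hasFDerivAt.comp_hasDerivAt t hsd
    refine ⟨_, hJd, ?_⟩
    obtain ⟨L, hL, hLe⟩ := P.hasFDerivAt_stateParam (k := k) ρ κ (s := e.symm (Z t)) (hJG t ht).1
    have hLs : L s' = (deriv qt t, iteratedDeriv 2 qt t,
        fun i => iteratedDeriv (i.val + 1) w t) :=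
      ((hL.comp_hasDerivAt t hsd).congr_of_eventuallyEq
        (Filter.eventuallyEq_of_mem (hI.mem_nhds ht) fun s hs => (hΨZ s hs).symm)).unique hZd
    have hLinj : ∀ ξ, L ξ = 0 → ξ = 0 := by
      obtain ⟨L', hL'⟩ := (hcl.mem t ht).2.2
      intro ξ hξ
      have : L = (L' : _ →L[ℝ] FbArg m k ρ) := by
        rw [hL']; exact hL.fderiv.symm
      rw [this] at hξ
      exact L'.injective (hξ.trans (map_zero _).symm)
    rw [hLe] at hLs
    have hs1 := congrArg (fun z => z.1) hLs
    have hs2 := congrArg (fun z => z.2.1) hLs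
    have hs3 : s'.2 = fun i => iteratedDeriv (i.val + 1) w t := congrArg (fun z => z.2.2) hLs
    dsimp only at hs1 hs2
    -- The defect between the actual and the formal derivative, in the orders below `κ`. In the
    -- higher orders below `ρ` there is none, because those entries are derivatives of `w`.
    let ξ : (Σ j, Fin (κ j)) → ℝ := fun p =>
      s'.1 p - jetCoord ρ m (p.2.val + 1) (J t) p.1
    have hdiff : ∀ i < ρ, jetCoord ρ m i
        (embedJet κ ρ s' - jetShift ρ m (J t) - embedJet κ ρ (ξ, 0)) = 0 := by
      intro i hi
      funext j
      rw [map_sub, map_sub, jetCoord_embedJet_zero hi.le, jetCoord_jetShift]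
      simp only [Pi.sub_apply, Pi.zero_apply]
      rw [← Prod.mk.eta (p := s'), jetCoord_embedJet hi.le]
      rcases Nat.lt_or_ge i (κ j) with h | h
      · rw [extend_of_lt h, extend_of_lt h, if_neg (Nat.not_le.2 h)]
        simp [ξ]
      · rw [extend_of_le h, extend_of_le h, if_pos h, hJcoord t ht (i + 1) hi j (by omega), hs3,
          jetCoord_of_lt _ (by omega)]
        simp only
        rw [Nat.sub_add_comm h]
        ring
    have hzero : ∀ {V : Type} [NormedAddCommGroup V] [NormedSpace ℝ V] (H : Jet ρ m → V) (a : ℕ),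
        HasOrder a H → a < ρ → fderiv ℝ H (J t) (embedJet κ ρ (ξ, 0)) =
          fderiv ℝ H (J t) (embedJet κ ρ s') - fderiv ℝ H (J t) (jetShift ρ m (J t)) := by
      intro V _ _ H a hH ha
      have := hH.fderiv_apply (J t) fun i hi => hdiff i (by omega)
      rw [map_sub, map_sub, sub_eq_zero] at this
      exact this.symm
    -- Actual and formal derivatives of `q̃` and `ṽ` agree: both are `deriv qt t` for `q̃`, and
    -- `hmotion` identifies them for `ṽ`. Injectivity of `L` then forces `ξ = 0`.
    have hξ : L (ξ, 0) = 0 := by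
      rw [hLe]
      refine Prod.ext ?_ (Prod.ext ?_ rfl)
      · have h1 := hzero (P.Fqr ρ) P.r (P.hasOrder_Fqr ρ) (by omega)
        refine (congrArg (statePartL m k) h1).trans ?_
        rw [map_sub]
        exact sub_eq_zero.2 (hs1.trans (hJv t ht).symm)
      · have h1 := hzero _ (P.r + 1) (P.hasOrder_Fqr ρ).lieD (by omega)
        refine (congrArg (statePartL m k) h1).trans ?_
        rw [map_sub]
        exact sub_eq_zero.2 (hs2.trans (hmotion t ht))
    have hξ0 : ξ = 0 := congrArg Prod.fst (hLinj _ hξ)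
    intro i hi
    have := hdiff i hi
    rw [hξ0, show ((0 : (Σ j, Fin (κ j)) → ℝ), (0 : Jet ρ m)) = 0 from rfl, map_zero, sub_zero,
      map_sub, sub_eq_zero, jetCoord_jetShift] at this
    exact this
  have hcomp : ∀ t ∈ I, ∀ (H : Jet ρ m → Tup m) (a : ℕ), HasOrder a H → a < ρ →
      ContDiffOn ℝ ∞ H (P.dom ρ) →
      HasDerivAt (fun s => H (J s)) (lieD (jetShift ρ m) H (J t)) t := by
    intro t ht H a hH ha hsm
    obtain ⟨J', hJ', hJ'i⟩ := hJder t ht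
    have h1 := (hsm.hasFDerivAt_of_isOpen hO (hJG t ht).1).comp_hasDerivAt t hJ'
    have h2 := hH.fderiv_apply (J t) (e := J' - jetShift ρ m (J t)) fun i hi => by
      rw [map_sub, jetCoord_jetShift, hJ'i i (by omega), sub_self]
    rw [map_sub, sub_eq_zero] at h2
    rw [h2] at h1
    exact h1
  intro t ht
  refine ⟨hcomp t ht _ P.r (P.hasOrder_inputParam ρ) (by omega) (P.contDiffOn_inputParam ρ),
    hcomp t ht _ (P.r + 1) (P.hasOrder_inputParam ρ).lieD (by omega)
      (contDiffOn_lieD hO hsh (P.contDiffOn_inputParam ρ)), fun j => ?_⟩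
  have hout : ∀ s ∈ I, P.φ (assemble hk (qt s) (α 0 (Z s))) j = jetCoord ρ m 0 (J s) j := by
    intro s hs
    rw [← (P.param_identities ρ (hJG s hs).1).2.1, ← hJq s hs]
    congr 2
    exact assemble_statePart hk _ _
  have hd : ∀ i < κ j, ∀ s ∈ I, HasDerivAt (fun s => jetCoord ρ m i (J s) j)
      (jetCoord ρ m (i + 1) (J s) j) s := by
    intro i hi s hs
    obtain ⟨J', hJ', hJ'i⟩ := hJder s hs
    rw [← hJ'i i (hi.trans_le (hκρ j))]
    exact hasDerivAt_pi.1 ((jetCoord ρ m i).hasFDerivAt.comp_hasDerivAt s hJ') j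
  rw [iteratedDeriv_eq_of_hasDerivAt (d := fun i s => jetCoord ρ m i (J s) j) hI hout hd le_rfl
    t ht, hJcoord t ht _ (hκρ j) j le_rfl, Nat.sub_self, iteratedDeriv_zero]

end LCSystem

end

end LagrangianFlatness

theorem theorem5 {m k : ℕ} (hk1 : 1 ≤ k) (hk : k ≤ m)
    (S : LagrangianFlatness.LCSystem m)
    (qs : LagrangianFlatness.Cfg m) (us : LagrangianFlatness.Tup m)
    (hs : S.IsEquilibrium qs us)
    (P : S.ConfigFlat qs us)
    (R : S.GenRep k qs us)
    (κ : Fin m → ℕ) :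
    (LagrangianFlatness.LCSystem.LinearizableBy R hk P κ →
      (∃ σ : Equiv.Perm (Fin m), κ ∘ σ = LagrangianFlatness.kappaOne m (m + 1 - k)) ∨
      (∃ (σ : Equiv.Perm (Fin m)) (j : Fin m),
        j.val < m - k ∧ κ ∘ σ = LagrangianFlatness.kappaTwo m (m - k) j)) ∧
    (∀ σ : Equiv.Perm (Fin m), κ ∘ σ = LagrangianFlatness.kappaOne m (m + 1 - k) →
      (LagrangianFlatness.LCSystem.LinearizableBy R hk P κ ↔
        (LagrangianFlatness.firstCols (m + 1 - k) σ (P.jac k 0)).rank = m + 1 - k)) ∧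
    (∀ (σ : Equiv.Perm (Fin m)) (j : Fin m),
      j.val < m - k → κ ∘ σ = LagrangianFlatness.kappaTwo m (m - k) j →
      (LagrangianFlatness.LCSystem.LinearizableBy R hk P κ ↔
        (Matrix.fromCols (LagrangianFlatness.firstCols (m - k) σ (P.jac k 0))
          (LagrangianFlatness.oneCol (σ j) (P.jac k 2))).rank = m + 1 - k)) := by
  have hiff : LagrangianFlatness.LCSystem.LinearizableBy R hk P κ ↔
      Function.Bijective (LagrangianFlatness.stateMap (P.jac k 0) (P.jac k 2) κ) :=
    ⟨LagrangianFlatness.LCSystem.stateMap_bijective_of_linearizableBy hs P R hk,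
      LagrangianFlatness.LCSystem.linearizableBy_of_stateMap_bijective hs P R hk⟩
  have hcard : Fintype.card (LagrangianFlatness.StIdx m k) = m + 1 - k :=
    LagrangianFlatness.card_stIdx hk
  rw [hiff]
  refine ⟨fun h => ?_, fun σ hσ => ?_, fun σ j hj hσ => ?_⟩
  · obtain ⟨b, c, hbc⟩ := P.exists_jac_two_eq hs k
    have := LagrangianFlatness.forms_of_stateMap_bijective hbc h
    rwa [hcard, show m + 1 - k - 1 = m - k by omega] at this
  · exact LagrangianFlatness.stateMap_bijective_iff_rank_one hcard (by omega) σ hσ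
  · have hn : m + 1 - k = m - k + 1 := by omega
    rw [hn]
    exact LagrangianFlatness.stateMap_bijective_iff_rank_two (hcard.trans hn) (by omega) σ hj hσ
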